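/- **Setting.** Let $\mathcal G$ be a strongly connected digraph on $\{1,\dots,n\}$. Let $\mathcal A=[a_{ij}]$ (row-stochastic) and $\mathcal B=[b_{ij}]$ (column-stochastic) be weight matrices with $a_{ij},b_{ij}>0$ if $i=j$ or $(j,i)$ is an edge, and $a_{ij}=b_{ij}=0$ otherwise. Let $\alpha,\beta\in(0,1)$, $\mathcal A_\alpha=(1-\alpha)I+\alpha\mathcal A$, $\mathcal B_\beta=(1-\beta)I+\beta\mathcal B$, and let $\pi_{\mathcal A},\pi_{\mathcal B}\ge 0$ be the vectors with entries summing to $1$ and $\pi_{\mathcal A}^{T}\mathcal A=\pi_{\mathcal A}^{T}$, $\mathcal B\pi_{\mathcal B}=\pi_{\mathcal B}$. Let $f_i:\mathbb R^m\to\mathbb R$ be differentiable, $\mu$-strongly convex and $L$-smooth ($\mu,L>0$), and let $x^\star$ be the minimizer of $\sum_i f_i$. **Norms.** Let $\|\cdot\|_{\mathcal A},\|\cdot\|_{\mathcal B}$ be norms on $\mathbb R^n$ with $\|v\|_2\le\|v\|_{\mathcal A},\|v\|_{\mathcal B}$, $\|v\|_{\mathcal A}\le\delta_{\mathcal{AB}}\|v\|_{\mathcal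 B}$, $\|v\|_{\mathcal A}\le\delta_{\mathcal A2}\|v\|_2$, $\|v\|_{\mathcal B}\le\delta_{\mathcal B2}\|v\|_2$ for all $v$ (with positive constants $\delta$), such that, for the induced operator norms, $\sigma_{\mathcal A}=\|\mathcal A_\alpha-\mathbf 1\pi_{\mathcal A}^T\|_{\mathcal A}<1$ and $\sigma_{\mathcal B}=\|\mathcal B_\beta-\pi_{\mathcal B}\mathbf 1^T\|_{\mathcal B}<1$. For $X\in\mathbb R^{n\times m}$, $\|X\|$ is the square root of the sum of the squared norms of the columns. **Algorithm.** Let $Q_K$ be the coordinatewise uniform quantizer with levels $0,\pm1,\dots,\pm K$ (rounding to the nearest integer, clipped at $\pm K$); it saturates at $u$ if $\|u\|_\infty>K+\frac12$. With $h(k)=C\xi^k$, $p_i(0)=s_i(0)=0$, the algorithm is, for $k\ge 1$, $$p_i(k)=h(k-1)\,Q_{K_x(k)}\!\Big(\tfrac{x_i(k)-p_i(k-1)}{h(k-1)}\Big)+p_i(k-1),\qquad s_i(k)=h(k-1)\,Q_{K_y(k)}\!\Big(\tfrac{y_i(k)-s_i(k-1)}{h(k-1)}\Big)+s_i(k-1),$$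 and, for $k\ge 0$, $$x_i(k+1)=x_i(k)+\alpha\sum_j a_{ij}(p_j(k)-p_i(k))-\eta(y_i(k)-y_i(k-1)),$$ $$y_i(k+1)=(1-\beta)y_i(k)+\beta\sum_j b_{ij}s_j(k)+\nabla f_i(x_i(k+1)),$$ with arbitrary $x(0)$, $y(-1)$, and with $y(0)$ satisfying $\sum_i y_i(0)=0$ and $\|y_i(0)\|_\infty\le \frac{C}{2\xi}$ for all $i$ (for example $y(0)=0$). **Constants.** $\tilde\eta=\eta\,\pi_{\mathcal A}^T\pi_{\mathcal B}$, $\kappa_1=\|I-\mathbf 1\pi_{\mathcal A}^T\|_{\mathcal A}$, $\kappa_2=\|\pi_{\mathcal B}\|_{\mathcal A}$, $\kappa_3=\|I-\pi_{\mathcal B}\mathbf 1^T\|_{\mathcal B}$, $\kappa_4=\|\mathcal A_\alpha-I\|_2$, $\kappa_5=\|\pi_{\mathcal B}\|_2$, $\kappa_6=\|\pi_{\mathcal A}\|_2$, $\kappa_7=\max\{\sqrt2(n+\frac12)\alpha+\eta\sqrt nL,\ \eta,\ \eta nL\}$, $\kappa_8=\max\{1,\sqrt nL,nL\}$, $$G=\begin{bmatrix}1-\tilde\eta\mu&\sqrt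 n\,\tilde\eta L&\eta\kappa_6\\ n\eta L\kappa_1\kappa_2&\sigma_{\mathcal A}+\sqrt n\eta L\kappa_1\kappa_2&\eta\delta_{\mathcal{AB}}\kappa_1\\ \delta_{\mathcal B2}n\eta L^2\kappa_3\kappa_5&\delta_{\mathcal B2}\kappa_3(L\kappa_4+\sqrt n\eta L^2\kappa_5)&\sigma_{\mathcal B}+\delta_{\mathcal B2}\eta L\kappa_3\end{bmatrix},$$ $\Gamma_1=\delta_{\mathcal{AB}}\delta_{\mathcal B2}\sqrt nL^2\pi_{\mathcal A}^T\pi_{\mathcal B}\kappa_1\kappa_3\kappa_5(nL+\mu)$, $\Gamma_2=\delta_{\mathcal B2}nL^2\kappa_1\kappa_2\kappa_3\kappa_4\kappa_6+\delta_{\mathcal B2}nL^2\kappa_3\kappa_5\kappa_6(1-\sigma_{\mathcal A})+n^{3/2}L^2\pi_{\mathcal A}^T\pi_{\mathcal B}\kappa_1\kappa_2(1-\sigma_{\mathcal B})+\delta_{\mathcal{AB}}\delta_{\mathcal B2}L\pi_{\mathcal A}^T\pi_{\mathcal B}\mu\kappa_1\kappa_3\kappa_4$, $\Gamma_3=\frac14\pi_{\mathcal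 A}^T\pi_{\mathcal B}\mu(1-\sigma_{\mathcal A})(1-\sigma_{\mathcal B})$. Let $\hat\rho=\rho(G)+\varpi$ with $\varpi>0$. Let $G=P^{-1}\Lambda P$ with $\Lambda$ in Jordan form, let $\|\cdot\|_{\mathcal C}$ be a submultiplicative matrix norm with $\|\Lambda\|_{\mathcal C}\le\hat\rho$ or $\|G\|_{\mathcal C}\le\hat\rho$, let $\tau\ge0$ satisfy $\|G^k\|_2\le\tau\|G^k\|_{\mathcal C}$ for all $k$, and put $\Pi=\tau\|P^{-1}\|_{\mathcal C}\|P\|_{\mathcal C}$. With $z(k)=y(k)-y(k-1)$, $\bar x=\pi_{\mathcal A}^Tx$, $\bar z=\mathbf 1^Tz$, put $\Theta(k)=(\|\bar x(k)-x^\star\|_2,\|x(k)-\mathbf 1\bar x(k)\|_{\mathcal A},\|z(k)-\pi_{\mathcal B}\bar z(k)\|_{\mathcal B})^T$ and $C_\Theta=\|\Theta(1)\|_2$. For $l\ge1$ let $\hat\varsigma(l)$ be the Euclidean norm of the vector with entries $\frac12\tilde\eta n\sqrt m\beta C\xi^{l-2}$, $\frac12\eta\kappa_1\kappa_2n\sqrt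 m\beta C\xi^{l-2}+\frac12\sqrt{mn}\,\delta_{\mathcal A2}\kappa_4C\xi^{l-1}$, $\frac12\delta_{\mathcal B2}\kappa_3n\sqrt m\beta C\xi^{l-2}(1+\xi+\eta L\kappa_5)+\frac12\delta_{\mathcal A2}\delta_{\mathcal B2}\kappa_3\kappa_4L\sqrt{mn}\,C\xi^{l-2}$. For $j\ge1$ put $U(j)=\xi^{-j}\big(\Pi C_\Theta\hat\rho^{\,j}+\Pi\sum_{l=1}^{j-1}\hat\rho^{\,j-l}\hat\varsigma(l)+\hat\varsigma(j)\big)$. **Theorem.** Let $C>0$, $\xi\in(\hat\rho,1)$, and $$0\le\eta\le\min\Big\{\tfrac1{(\mu+L)\pi_{\mathcal A}^T\pi_{\mathcal B}},\ \tfrac{1-\sigma_{\mathcal A}}{2\sqrt n\kappa_1\kappa_2L},\ \tfrac{1-\sigma_{\mathcal B}}{2\delta_{\mathcal B2}\kappa_3L},\ \tfrac{2\Gamma_3}{\Gamma_2+\sqrt{\Gamma_2^2+4\Gamma_1\Gamma_3}}\Big\}$$ (a quotient with denominator $0$ counts as $+\infty$). Suppose that $K_x(1)\ge\frac{\|x_i(1)\|_\infty}{C}-\frac12$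 and $K_y(1)\ge\frac{\|y_i(1)\|_\infty}{C}-\frac12$ for all $i$, and $$K_x(2)\ge\tfrac{\sqrt3\kappa_7}{C\xi}C_\Theta+\tfrac{2\alpha n+1}{2\xi}-\tfrac12,$$ $$K_x(k)\ge\tfrac{\sqrt3\kappa_7}{C\xi}U(k-2)+\tfrac{2\alpha n+1}{2\xi}+\tfrac{n\eta\beta}{2\xi^2}-\tfrac12\quad(k\ge3),$$ $$K_y(k)\ge\tfrac{\sqrt3\kappa_8}{C}U(k-1)+\tfrac{n\sqrt m\beta+1}{2\xi}-\tfrac12\quad(k\ge2).$$ Then the quantizers never saturate: for all $k\ge1$ and all $i$, $\big\|\frac{x_i(k)-p_i(k-1)}{h(k-1)}\big\|_\infty\le K_x(k)+\frac12$ and $\big\|\frac{y_i(k)-s_i(k-1)}{h(k-1)}\big\|_\infty\le K_y(k)+\frac12$. -/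

import Mathlib

open scoped Matrix

noncomputable section

/-- The decision space `ℝ^m` with the Euclidean norm. -/
abbrev Vec (m : ℕ) := EuclideanSpace ℝ (Fin m)

/-! ### Norms -/

/-- Euclidean norm of a vector given by its coordinates. -/
def l2 {ι : Type*} [Fintype ι] (v : ι → ℝ) : ℝ := ‖(WithLp.toLp 2 v : EuclideanSpace ℝ ι)‖

/-- Sup norm on `ℝ^m`. -/
def supNorm {m : ℕ} (u : Vec m) : ℝ := ‖(WithLp.ofLp u : Fin m → ℝ)‖

/-- Spectral norm (operator norm for the Euclidean norm) of a real square matrix. -/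
def l2op {n : ℕ} (M : Matrix (Fin n) (Fin n) ℝ) : ℝ := ‖Matrix.toEuclideanCLM (𝕜 := ℝ) M‖

/-- Norm of a square matrix induced by the vector norm `N`: least `c ≥ 0` with
`N (M v) ≤ c * N v` for all `v`. -/
def opN {n : ℕ} (N : Seminorm ℝ (Fin n → ℝ)) (M : Matrix (Fin n) (Fin n) ℝ) : ℝ :=
  sInf {c : ℝ | 0 ≤ c ∧ ∀ v, N (M *ᵥ v) ≤ c * N v}

/-- Norm of an `n × m` matrix `X` (rows `X i`, one per node) induced by the norm `N` on `ℝ^n`: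
the square root of the sum of the squared norms of the columns. -/
def colN {n m : ℕ} (N : Seminorm ℝ (Fin n → ℝ)) (X : Fin n → Vec m) : ℝ :=
  Real.sqrt (∑ c, (N fun i => X i c) ^ 2)

/-! ### Network -/

/-- Every node can be reached from every other one by a directed path. -/
def StronglyConnected {n : ℕ} (E : Digraph (Fin n)) : Prop :=
  ∀ i j, Relation.ReflTransGen E.Adj i j

/-- `W` is a weight matrix induced by the digraph `E` with self-loops added: `w_ij > 0` if `i = j`
or `(j, i)` is an edge (node `i` receives from node `j`), and `w_ij = 0` otherwise. -/
def IsWeightMatrix {n : ℕ} (E : Digraph (Fin n)) (W : Matrix (Fin n) (Fin n) ℝ) : Prop :=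
  ∀ i j, ((i = j ∨ E.Adj j i) → 0 < W i j) ∧ (¬(i = j ∨ E.Adj j i) → W i j = 0)

/-! ### Quantizer -/

/-- Scalar uniform quantizer with the `2K+1` levels `0, ±1, …, ±K`: for `u ≥ 0` round to the nearest
integer (halves are rounded up) and clip at `K`; extended as an odd function. -/
def quant (K : ℕ) (u : ℝ) : ℝ :=
  if 0 ≤ u then ((min ⌊u + 1 / 2⌋ (K : ℤ) : ℤ) : ℝ) else -((min ⌊-u + 1 / 2⌋ (K : ℤ) : ℤ) : ℝ)

/-- The quantizer `Q_K`, applied to each coordinate. -/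
def Quant {m : ℕ} (K : ℕ) (u : Vec m) : Vec m := WithLp.toLp 2 fun c => quant K (u c)

/-- The quantizer `Q_K` saturates at the input `u`: some coordinate exceeds `K + 1/2` in absolute
value (equivalently, the error of `Q_K` in some coordinate exceeds `1/2`). -/
def Saturates {m : ℕ} (K : ℕ) (u : Vec m) : Prop := (K : ℝ) + 1 / 2 < supNorm u

/-! ### Parameters and constants -/

/-- The data: local cost functions, weight matrices, algorithm parameters, the Perron vectors of
the weight matrices, the two vector norms, and the norm-equivalence constants. -/
structure Params (n m : ℕ) where
  f : Fin n → Vec m → ℝ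
  A : Matrix (Fin n) (Fin n) ℝ
  B : Matrix (Fin n) (Fin n) ℝ
  α : ℝ
  β : ℝ
  η : ℝ
  μ : ℝ
  L : ℝ
  C : ℝ
  ξ : ℝ
  πA : Fin n → ℝ
  πB : Fin n → ℝ
  NA : Seminorm ℝ (Fin n → ℝ)
  NB : Seminorm ℝ (Fin n → ℝ)
  δAB : ℝ
  δA2 : ℝ
  δB2 : ℝ

namespace Params

variable {n m : ℕ} (D : Params n m)

/-- Scaling function `h(k) = C ξ^k`. -/
def h (k : ℕ) : ℝ := D.C * D.ξ ^ k

def Aα : Matrix (Fin n) (Fin n) ℝ := (1 - D.α) • 1 + D.α • D.A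

def Bβ : Matrix (Fin n) (Fin n) ℝ := (1 - D.β) • 1 + D.β • D.B

/-- `π_Aᵀ π_B`. -/
def ππ : ℝ := D.πA ⬝ᵥ D.πB

def ηt : ℝ := D.η * D.ππ

def σA : ℝ := opN D.NA (D.Aα - Matrix.vecMulVec 1 D.πA)

def σB : ℝ := opN D.NB (D.Bβ - Matrix.vecMulVec D.πB 1)

def κ1 : ℝ := opN D.NA (1 - Matrix.vecMulVec 1 D.πA)

def κ2 : ℝ := D.NA D.πB

def κ3 : ℝ := opN D.NB (1 - Matrix.vecMulVec D.πB 1)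

def κ4 : ℝ := l2op (D.Aα - 1)

def κ5 : ℝ := l2 D.πB

def κ6 : ℝ := l2 D.πA

def κ7 : ℝ :=
  max (Real.sqrt 2 * (n + 1 / 2) * D.α + D.η * Real.sqrt n * D.L) (max D.η (D.η * n * D.L))

def κ8 : ℝ := max 1 (max (Real.sqrt n * D.L) (n * D.L))

/-- The matrix of the linear system of inequalities. -/
def G : Matrix (Fin 3) (Fin 3) ℝ :=
  !![1 - D.ηt * D.μ,
      Real.sqrt n * D.ηt * D.L,
      D.η * D.κ6;
    n * D.η * D.L * D.κ1 * D.κ2,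
      D.σA + Real.sqrt n * D.η * D.L * D.κ1 * D.κ2,
      D.η * D.δAB * D.κ1;
    D.δB2 * n * D.η * D.L ^ 2 * D.κ3 * D.κ5,
      D.δB2 * D.κ3 * (D.L * D.κ4 + Real.sqrt n * D.η * D.L ^ 2 * D.κ5),
      D.σB + D.δB2 * D.η * D.L * D.κ3]

def Γ1 : ℝ :=
  D.δAB * D.δB2 * Real.sqrt n * D.L ^ 2 * D.ππ * D.κ1 * D.κ3 * D.κ5 * (n * D.L + D.μ)

def Γ2 : ℝ :=
  D.δB2 * n * D.L ^ 2 * D.κ1 * D.κ2 * D.κ3 * D.κ4 * D.κ6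
    + D.δB2 * n * D.L ^ 2 * D.κ3 * D.κ5 * D.κ6 * (1 - D.σA)
    + n * Real.sqrt n * D.L ^ 2 * D.ππ * D.κ1 * D.κ2 * (1 - D.σB)
    + D.δAB * D.δB2 * D.L * D.ππ * D.μ * D.κ1 * D.κ3 * D.κ4

def Γ3 : ℝ := 1 / 4 * D.ππ * D.μ * (1 - D.σA) * (1 - D.σB)

/-- The step-size range: `η` is at most the minimum of the four quotients
`1/((μ+L) π_Aᵀπ_B)`, `(1-σ_A)/(2√n κ₁κ₂L)`, `(1-σ_B)/(2δ_{B2}κ₃L)`, `2Γ₃/(Γ₂+√(Γ₂²+4Γ₁Γ₃))`.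
The denominators are multiplied out, so that a vanishing one (`n = 1`) imposes no restriction. -/
def StepRange : Prop :=
  0 ≤ D.η ∧
  D.η * ((D.μ + D.L) * D.ππ) ≤ 1 ∧
  D.η * (2 * Real.sqrt n * D.κ1 * D.κ2 * D.L) ≤ 1 - D.σA ∧
  D.η * (2 * D.δB2 * D.κ3 * D.L) ≤ 1 - D.σB ∧
  D.η * (D.Γ2 + Real.sqrt (D.Γ2 ^ 2 + 4 * D.Γ1 * D.Γ3)) ≤ 2 * D.Γ3

/-! ### The error bounds -/

def ς1 (l : ℕ) : ℝ := 1 / 2 * D.ηt * n * Real.sqrt m * D.β * D.C * D.ξ ^ ((l : ℤ) - 2)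

def ς2 (l : ℕ) : ℝ :=
  1 / 2 * D.η * D.κ1 * D.κ2 * n * Real.sqrt m * D.β * D.C * D.ξ ^ ((l : ℤ) - 2)
    + 1 / 2 * Real.sqrt (m * n) * D.δA2 * D.κ4 * D.C * D.ξ ^ ((l : ℤ) - 1)

def ς3 (l : ℕ) : ℝ :=
  1 / 2 * D.δB2 * D.κ3 * n * Real.sqrt m * D.β * D.C * D.ξ ^ ((l : ℤ) - 2)
      * (1 + D.ξ + D.η * D.L * D.κ5)
    + 1 / 2 * D.δA2 * D.δB2 * D.κ3 * D.κ4 * D.L * Real.sqrt (m * n) * D.C * D.ξ ^ ((l : ℤ) - 2)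

/-- `ς̂(l)`, for `l ≥ 1`. -/
def ςhat (l : ℕ) : ℝ := l2 ![D.ς1 l, D.ς2 l, D.ς3 l]

/-! ### Optimality and consensus errors -/

/-- The vector `Θ` belonging to the node states `x`, the node increments `z` and the optimal
solution `xs`. -/
def Θ (xs : Vec m) (x z : Fin n → Vec m) : Fin 3 → ℝ :=
  ![‖(∑ i, D.πA i • x i) - xs‖,
    colN D.NA fun i => x i - ∑ j, D.πA j • x j,
    colN D.NB fun i => z i - D.πB i • ∑ j, z j]

/-- `Π C_Θ Υ`, with the denominators `Π` and `C_Θ` of the summands of `Υ` cancelled: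
`Υ₁(k)` belongs to `j = k - 2` and `Υ₂(k)` to `j = k - 1`. -/
def upsBound (rhat Pc CΘ : ℝ) (j : ℕ) : ℝ :=
  (Pc * CΘ * rhat ^ j + Pc * (∑ l ∈ Finset.Icc 1 (j - 1), rhat ^ (j - l) * D.ςhat l) + D.ςhat j)
    / D.ξ ^ j

/-! ### The algorithm -/

/-- Input of the `x`-quantizer (`y`-quantizer) of node `i` at time `k ≥ 1`, where `p` (`s`) is the
internal variable of its encoder. -/
def qInput (x p : ℕ → Fin n → Vec m) (k : ℕ) (i : Fin n) : Vec m :=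
  (1 / D.h (k - 1)) • (x k i - p (k - 1) i)

/-- `x, y, p, s` is a run of the quantized gradient tracking algorithm with quantization levels
`Kx`, `Ky`; `ym` is the value of `y` at time `-1`, which enters only the first update of `x`. -/
structure IsRun (Kx Ky : ℕ → ℕ) (ym : Fin n → Vec m) (x y p s : ℕ → Fin n → Vec m) : Prop where
  p_zero : ∀ i, p 0 i = 0
  s_zero : ∀ i, s 0 i = 0
  p_succ : ∀ k i,
    p (k + 1) i = D.h k • Quant (Kx (k + 1)) (D.qInput x p (k + 1) i) + p k i
  s_succ : ∀ k i,
    s (k + 1) i = D.h k • Quant (Ky (k + 1)) (D.qInput y s (k + 1) i) + s k i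
  x_one : ∀ i,
    x 1 i = x 0 i + D.α • ∑ j, D.A i j • (p 0 j - p 0 i) - D.η • (y 0 i - ym i)
  x_succ : ∀ k i,
    x (k + 2) i = x (k + 1) i + D.α • ∑ j, D.A i j • (p (k + 1) j - p (k + 1) i)
      - D.η • (y (k + 1) i - y k i)
  y_succ : ∀ k i,
    y (k + 1) i = (1 - D.β) • y k i + D.β • ∑ j, D.B i j • s k j + gradient (D.f i) (x (k + 1) i)

end Params

/-! ### The constant of the geometric bound -/

/-- Spectral radius of a real square matrix. -/
def specRad (G : Matrix (Fin 3) (Fin 3) ℝ) : ℝ :=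
  (spectralRadius ℂ (G.map Complex.ofReal)).toReal

/-- `Λ` is in Jordan form. -/
def IsJordanForm (Λ : Matrix (Fin 3) (Fin 3) ℂ) : Prop :=
  (∀ i j : Fin 3, Λ i j ≠ 0 → j = i ∨ (j : ℕ) = (i : ℕ) + 1) ∧
  ∀ i j : Fin 3, (j : ℕ) = (i : ℕ) + 1 → Λ i j = 0 ∨ (Λ i j = 1 ∧ Λ i i = Λ j j)

/-- `Pc = τ ‖P⁻¹‖_C ‖P‖_C`, where `G = P⁻¹ Λ P` with `Λ` in Jordan form, `‖·‖_C = N` is a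
(submultiplicative) matrix norm for which `Λ`, or `G` itself, has norm at most `rhat`, and `τ` is a
constant with `‖G^k‖₂ ≤ τ ‖G^k‖_C` for all `k`. -/
def IsGeomConst (G : Matrix (Fin 3) (Fin 3) ℝ) (rhat Pc : ℝ) : Prop :=
  ∃ (P Λ : Matrix (Fin 3) (Fin 3) ℂ) (N : Seminorm ℂ (Matrix (Fin 3) (Fin 3) ℂ)) (τ : ℝ),
    IsUnit P.det ∧ IsJordanForm Λ ∧ G.map Complex.ofReal = P⁻¹ * Λ * P ∧
    (∀ M, N M = 0 → M = 0) ∧ (∀ M M', N (M * M') ≤ N M * N M') ∧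
    (N Λ ≤ rhat ∨ N (G.map Complex.ofReal) ≤ rhat) ∧
    0 ≤ τ ∧ (∀ k : ℕ, l2op (G ^ k) ≤ τ * N ((G ^ k).map Complex.ofReal)) ∧
    Pc = τ * N P⁻¹ * N P

end

/-! The proof is a bootstrap in time. While no quantizer has saturated, every encoding error is at
most half the current scale, so the iteration is exact gradient tracking with a geometrically
decaying perturbation. Put z(k) = y(k) - y(k-1). Since the columns of `B` sum to 1, the total of
z(k) is the sum of the local gradients plus β times the total encoding error of y(k-1)
(`IsRun.z_sum`): past errors do not accumulate.

The vector `Θ` collects the optimality error of the average, the disagreement of the states, and the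
deviation of z from the direction `πB`. The average performs an inexact gradient step for the total
cost, and such a step contracts by co-coercivity (`norm_gradient_step_le`). The other two errors
contract because the projections `RA` and `RB` turn `Aα` and `Bβ` into the matrices of norm `σA` and
`σB`. This gives Θ(k+1) ≤ G Θ(k) + ς(k) entrywise (`Step.Θ_le`). One point is hidden in the
step-size range: the gradient step needs `ηt` · n(μ+L) ≤ 1, which for n ≥ 2 comes from the quotient
with the Γ's (`ηt_mul_le_one`).

As `G` is nonnegative, the inequality can be iterated; the bound on powers of `G`
(`IsGeomConst.l2op_pow_le`) then yields ‖Θ(j+1)‖ ≤ ξ^j U(j) (`l2_Θ_le`). Since Θ(k+1) depends only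
on errors up to time k, it is under control before the quantizers act at time k+1. Their unscaled
inputs are an increment of x or y corrected by the last encoding error, hence bounded through `Θ`;
the prescribed levels dominate these bounds (`not_saturates`), and the induction closes. -/

noncomputable section

/-! ### Euclidean and sup norms -/

lemma l2_eq_sqrt {ι : Type*} [Fintype ι] (v : ι → ℝ) : l2 v = Real.sqrt (∑ i, v i ^ 2) := by
  simp [l2, EuclideanSpace.norm_eq]

lemma l2_nonneg {ι : Type*} [Fintype ι] (v : ι → ℝ) : 0 ≤ l2 v := norm_nonneg _

lemma l2_ofLp {m : ℕ} (u : Vec m) : l2 (fun c => u c) = ‖u‖ := by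
  simp [l2_eq_sqrt, EuclideanSpace.norm_eq]

lemma l2_add_le {ι : Type*} [Fintype ι] (v w : ι → ℝ) : l2 (v + w) ≤ l2 v + l2 w := by
  simpa [l2] using norm_add_le (WithLp.toLp 2 v : EuclideanSpace ℝ ι) (WithLp.toLp 2 w)

lemma l2_smul {ι : Type*} [Fintype ι] (a : ℝ) (v : ι → ℝ) : l2 (a • v) = |a| * l2 v := by
  simp [l2, norm_smul]

lemma l2_le_of_abs_le {ι : Type*} [Fintype ι] {v w : ι → ℝ} (h : ∀ i, |v i| ≤ w i) :
    l2 v ≤ l2 w := by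
  rw [l2_eq_sqrt, l2_eq_sqrt]
  refine Real.sqrt_le_sqrt (Finset.sum_le_sum fun i _ => ?_)
  rw [← sq_abs]
  exact pow_le_pow_left₀ (abs_nonneg _) (h i) 2

lemma l2_le_of_le {ι : Type*} [Fintype ι] {v w : ι → ℝ} (h0 : ∀ i, 0 ≤ v i)
    (h : ∀ i, v i ≤ w i) : l2 v ≤ l2 w :=
  l2_le_of_abs_le fun i => by rw [abs_of_nonneg (h0 i)]; exact h i

lemma l2_const {ι : Type*} [Fintype ι] {b : ℝ} (hb : 0 ≤ b) :
    l2 (fun _ : ι => b) = Real.sqrt (Fintype.card ι) * b := by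
  rw [l2_eq_sqrt]
  simp [Real.sqrt_sq hb]

lemma abs_dotProduct_le_l2 {ι : Type*} [Fintype ι] (v w : ι → ℝ) :
    |v ⬝ᵥ w| ≤ l2 v * l2 w := by
  have := abs_real_inner_le_norm (WithLp.toLp 2 v : EuclideanSpace ℝ ι) (WithLp.toLp 2 w)
  simpa [l2, PiLp.inner_apply, dotProduct, mul_comm] using this

lemma l2_le_sum_abs {ι : Type*} [Fintype ι] (v : ι → ℝ) : l2 v ≤ ∑ i, |v i| := by
  rw [l2_eq_sqrt]
  refine Real.sqrt_le_iff.2 ⟨Finset.sum_nonneg fun i _ => abs_nonneg _, ?_⟩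
  calc ∑ i, v i ^ 2 = ∑ i, |v i| ^ 2 := by simp
    _ ≤ (∑ i, |v i|) ^ 2 := Finset.sum_sq_le_sq_sum_of_nonneg fun i _ => abs_nonneg _

lemma sum_abs_le_l2 {ι : Type*} [Fintype ι] (v : ι → ℝ) :
    ∑ i, |v i| ≤ Real.sqrt (Fintype.card ι) * l2 v := by
  have := abs_dotProduct_le_l2 (fun _ : ι => (1 : ℝ)) (fun i => |v i|)
  rw [l2_const zero_le_one, mul_one] at this
  have h2 : l2 (fun i => |v i|) = l2 v := by simp [l2_eq_sqrt]
  rw [h2] at this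
  refine le_trans (le_trans (le_of_eq ?_) (le_abs_self _)) this
  simp [dotProduct]

lemma l2_mulVec_le {n : ℕ} (M : Matrix (Fin n) (Fin n) ℝ) (v : Fin n → ℝ) :
    l2 (M *ᵥ v) ≤ l2op M * l2 v := by
  have := (Matrix.toEuclideanCLM (𝕜 := ℝ) M).le_opNorm (WithLp.toLp 2 v)
  simpa [l2op, l2] using this

lemma l2op_nonneg {n : ℕ} (M : Matrix (Fin n) (Fin n) ℝ) : 0 ≤ l2op M := norm_nonneg _

lemma supNorm_nonneg {m : ℕ} (u : Vec m) : 0 ≤ supNorm u := norm_nonneg _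

lemma supNorm_le_iff {m : ℕ} {u : Vec m} {b : ℝ} (hb : 0 ≤ b) :
    supNorm u ≤ b ↔ ∀ c, |u c| ≤ b := by
  simp [supNorm, pi_norm_le_iff_of_nonneg hb]

lemma abs_le_supNorm {m : ℕ} (u : Vec m) (c : Fin m) : |u c| ≤ supNorm u :=
  (supNorm_le_iff (supNorm_nonneg u)).1 le_rfl c

lemma supNorm_add_le {m : ℕ} (u v : Vec m) : supNorm (u + v) ≤ supNorm u + supNorm v := by
  simpa [supNorm] using norm_add_le (WithLp.ofLp u) (WithLp.ofLp v)

lemma supNorm_sub_le {m : ℕ} (u v : Vec m) : supNorm (u - v) ≤ supNorm u + supNorm v := by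
  simpa [supNorm] using norm_sub_le (WithLp.ofLp u) (WithLp.ofLp v)

lemma supNorm_neg {m : ℕ} (u : Vec m) : supNorm (-u) = supNorm u := by
  simp [supNorm]

lemma supNorm_smul {m : ℕ} (a : ℝ) (u : Vec m) : supNorm (a • u) = |a| * supNorm u := by
  simp [supNorm, norm_smul]

lemma supNorm_sum_le {m : ℕ} {ι : Type*} (s : Finset ι) (u : ι → Vec m) :
    supNorm (∑ i ∈ s, u i) ≤ ∑ i ∈ s, supNorm (u i) := by
  simpa [supNorm] using norm_sum_le s (fun i => WithLp.ofLp (u i))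

lemma abs_apply_le_norm {m : ℕ} (u : Vec m) (c : Fin m) : |u c| ≤ ‖u‖ := by
  simpa using PiLp.norm_apply_le u c

lemma supNorm_le_norm {m : ℕ} (u : Vec m) : supNorm u ≤ ‖u‖ :=
  (supNorm_le_iff (norm_nonneg u)).2 fun c => abs_apply_le_norm u c

lemma norm_le_sqrt_mul_supNorm {m : ℕ} (u : Vec m) : ‖u‖ ≤ Real.sqrt m * supNorm u := by
  rw [← l2_ofLp]
  refine (l2_le_of_abs_le fun c => abs_le_supNorm u c).trans ?_
  rw [l2_const (supNorm_nonneg u)]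
  simp

/-! ### Induced operator norms -/

section opN

variable {n : ℕ} {N : Seminorm ℝ (Fin n → ℝ)} {δ : ℝ}

lemma opN_nonneg (M : Matrix (Fin n) (Fin n) ℝ) : 0 ≤ opN N M :=
  Real.sInf_nonneg fun _ hc => hc.1

/-- Equivalence with the Euclidean norm makes the set defining `opN` nonempty, so that its infimum
is a genuine operator norm and not the default value 0. -/
lemma apply_mulVec_le_opN (hN : ∀ v, l2 v ≤ N v) (hδ : 0 < δ) (hNδ : ∀ v, N v ≤ δ * l2 v)
    (M : Matrix (Fin n) (Fin n) ℝ) (v : Fin n → ℝ) : N (M *ᵥ v) ≤ opN N M * N v := by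
  have hne : {c : ℝ | 0 ≤ c ∧ ∀ v, N (M *ᵥ v) ≤ c * N v}.Nonempty := by
    refine ⟨δ * l2op M, mul_nonneg hδ.le (l2op_nonneg M), fun w => ?_⟩
    calc N (M *ᵥ w) ≤ δ * (l2op M * l2 w) :=
          (hNδ _).trans (mul_le_mul_of_nonneg_left (l2_mulVec_le M w) hδ.le)
      _ ≤ δ * (l2op M * N w) := by
          gcongr
          · exact l2op_nonneg M
          · exact hN w
      _ = _ := by ring
  rcases (apply_nonneg N v).eq_or_lt with h0 | hpos
  · obtain ⟨c, -, hc⟩ := hne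
    have := hc v
    rw [← h0] at this ⊢
    simpa using this
  · rw [← div_le_iff₀ hpos]
    exact le_csInf hne fun c hc => (div_le_iff₀ hpos).2 (hc.2 v)

lemma one_le_opN_of_mulVec_eq (hN : ∀ v, l2 v ≤ N v) (hδ : 0 < δ) (hNδ : ∀ v, N v ≤ δ * l2 v)
    {M : Matrix (Fin n) (Fin n) ℝ} {v : Fin n → ℝ} (hv : v ≠ 0) (hMv : M *ᵥ v = v) :
    1 ≤ opN N M := by
  have hpos : 0 < N v := lt_of_lt_of_le (by simpa [l2] using hv) (hN v)
  have := apply_mulVec_le_opN hN hδ hNδ M v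
  rw [hMv] at this
  by_contra! hlt
  nlinarith

end opN

/-! ### Action of matrices on families of vectors -/

/-- The product of the `n × n` matrix `M` with the `n × m` matrix with rows `X i`. -/
def act {n m : ℕ} (M : Matrix (Fin n) (Fin n) ℝ) : (Fin n → Vec m) →ₗ[ℝ] (Fin n → Vec m) where
  toFun X i := ∑ j, M i j • X j
  map_add' X Y := by ext1 i; simp [Finset.sum_add_distrib]
  map_smul' a X := by ext1 i; simp [Finset.smul_sum, smul_comm a]

section act

variable {n m : ℕ}

lemma act_apply (M : Matrix (Fin n) (Fin n) ℝ) (X : Fin n → Vec m) (i : Fin n) :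
    act M X i = ∑ j, M i j • X j := rfl

lemma act_mul (M M' : Matrix (Fin n) (Fin n) ℝ) (X : Fin n → Vec m) :
    act (M * M') X = act M (act M' X) := by
  ext1 i
  simp only [act_apply, Matrix.mul_apply, Finset.sum_smul, Finset.smul_sum, mul_smul]
  exact Finset.sum_comm

lemma act_add_left (M M' : Matrix (Fin n) (Fin n) ℝ) (X : Fin n → Vec m) :
    act (M + M') X = act M X + act M' X := by
  ext1 i; simp [act_apply, add_smul, Finset.sum_add_distrib]

lemma act_sub_left (M M' : Matrix (Fin n) (Fin n) ℝ) (X : Fin n → Vec m) :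
    act (M - M') X = act M X - act M' X := by
  ext1 i; simp [act_apply, sub_smul, Finset.sum_sub_distrib]

lemma act_smul_left (a : ℝ) (M : Matrix (Fin n) (Fin n) ℝ) (X : Fin n → Vec m) :
    act (a • M) X = a • act M X := by
  ext1 i; simp [act_apply, mul_smul, Finset.smul_sum]

lemma act_one (X : Fin n → Vec m) : act 1 X = X := by
  ext1 i; simp [act_apply, Matrix.one_apply]

lemma act_vecMulVec (v w : Fin n → ℝ) (X : Fin n → Vec m) (i : Fin n) :
    act (Matrix.vecMulVec v w) X i = v i • ∑ j, w j • X j := by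
  simp [act_apply, Matrix.vecMulVec_apply, mul_smul, Finset.smul_sum]

lemma act_column (M : Matrix (Fin n) (Fin n) ℝ) (X : Fin n → Vec m) (c : Fin m) :
    (fun i => act M X i c) = M *ᵥ fun i => X i c := by
  ext i
  simp [act_apply, Matrix.mulVec, dotProduct]

end act

/-! ### Column norms -/

section colN

variable {n m : ℕ}

lemma colN_eq_l2 (N : Seminorm ℝ (Fin n → ℝ)) (X : Fin n → Vec m) :
    colN N X = l2 fun c => N fun i => X i c := by
  rw [colN, l2_eq_sqrt]

lemma colN_nonneg (N : Seminorm ℝ (Fin n → ℝ)) (X : Fin n → Vec m) : 0 ≤ colN N X :=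
  Real.sqrt_nonneg _

lemma colN_add_le (N : Seminorm ℝ (Fin n → ℝ)) (X Y : Fin n → Vec m) :
    colN N (X + Y) ≤ colN N X + colN N Y := by
  simp only [colN_eq_l2]
  refine le_trans (l2_le_of_le (fun c => apply_nonneg N _) fun c => ?_) (l2_add_le _ _)
  exact map_add_le_add N (fun i => X i c) (fun i => Y i c)

lemma colN_smul (N : Seminorm ℝ (Fin n → ℝ)) (a : ℝ) (X : Fin n → Vec m) :
    colN N (a • X) = |a| * colN N X := by
  simp only [colN_eq_l2]
  have h := l2_smul |a| fun c => N fun i => X i c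
  rw [abs_abs] at h
  rw [← h]
  congr 1
  ext c
  exact map_smul_eq_mul N a (fun i => X i c)

lemma colN_neg (N : Seminorm ℝ (Fin n → ℝ)) (X : Fin n → Vec m) :
    colN N (-X) = colN N X := by
  have := colN_smul N (-1) X
  simpa using this

lemma colN_sub_le (N : Seminorm ℝ (Fin n → ℝ)) (X Y : Fin n → Vec m) :
    colN N (X - Y) ≤ colN N X + colN N Y := by
  rw [sub_eq_add_neg, ← colN_neg N Y]
  exact colN_add_le N X (-Y)

lemma colN_le_mul {N N' : Seminorm ℝ (Fin n → ℝ)} {X Y : Fin n → Vec m} {a : ℝ} (ha : 0 ≤ a)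
    (h : ∀ c, N (fun i => X i c) ≤ a * N' fun i => Y i c) : colN N X ≤ a * colN N' Y := by
  simp only [colN_eq_l2]
  rw [← abs_of_nonneg ha, ← l2_smul]
  exact l2_le_of_le (fun c => apply_nonneg N _) fun c => by simpa [abs_of_nonneg ha] using h c

lemma colN_act_le {N N' : Seminorm ℝ (Fin n → ℝ)} {M : Matrix (Fin n) (Fin n) ℝ} {a : ℝ}
    (ha : 0 ≤ a) (h : ∀ v, N (M *ᵥ v) ≤ a * N' v) (X : Fin n → Vec m) :
    colN N (act M X) ≤ a * colN N' X :=
  colN_le_mul ha fun c => by rw [act_column]; exact h _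

/-- The columns are multiples of the single vector `v`, so `N v` factors out. This is how `κ2` and
`κ5` enter the estimates. -/
lemma colN_smul_const (N : Seminorm ℝ (Fin n → ℝ)) (v : Fin n → ℝ) (u : Vec m) :
    colN N (fun i => v i • u) = N v * ‖u‖ := by
  rw [colN_eq_l2, ← abs_of_nonneg (apply_nonneg N v), ← l2_ofLp, ← l2_smul]
  have : ∀ c, N (fun i => v i * u c) = N v * |u c| := fun c => by
    have := map_smul_eq_mul N (u c) v
    rw [Real.norm_eq_abs] at this
    rw [mul_comm, ← this]
    congr 1
    ext i
    simp [mul_comm]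
  simp only [l2_eq_sqrt, PiLp.smul_apply, smul_eq_mul, this, Pi.smul_apply, mul_pow, sq_abs]

/-- The Euclidean norm as a seminorm. -/
def l2Seminorm (n : ℕ) : Seminorm ℝ (Fin n → ℝ) :=
  Seminorm.of l2 l2_add_le fun a v => by rw [l2_smul, Real.norm_eq_abs]

/-- The Frobenius norm of the matrix with rows `X i`. -/
def frob (X : Fin n → Vec m) : ℝ := colN (l2Seminorm n) X

lemma frob_nonneg (X : Fin n → Vec m) : 0 ≤ frob X := colN_nonneg _ _

lemma frob_eq_l2_norm (X : Fin n → Vec m) : frob X = l2 fun i => ‖X i‖ := by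
  have h : ∀ c, (l2Seminorm n fun i => X i c) ^ 2 = ∑ i, X i c ^ 2 := fun c => by
    change (l2 fun i => X i c) ^ 2 = _
    rw [l2_eq_sqrt, Real.sq_sqrt (by positivity)]
  have h' : ∀ i, ‖X i‖ ^ 2 = ∑ c, X i c ^ 2 := fun i => by
    simp [EuclideanSpace.norm_sq_eq]
  rw [frob, colN, l2_eq_sqrt]
  simp only [h, h']
  rw [Finset.sum_comm]

lemma frob_le_colN {N : Seminorm ℝ (Fin n → ℝ)} (hN : ∀ v, l2 v ≤ N v) (X : Fin n → Vec m) :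
    frob X ≤ colN N X := by
  simpa [frob] using colN_le_mul (N := l2Seminorm n) (N' := N) (X := X) (Y := X) zero_le_one
    fun c => by rw [one_mul]; exact hN fun i => X i c

lemma colN_le_mul_frob {N : Seminorm ℝ (Fin n → ℝ)} {δ : ℝ} (hδ : 0 ≤ δ)
    (hN : ∀ v, N v ≤ δ * l2 v) (X : Fin n → Vec m) : colN N X ≤ δ * frob X :=
  colN_le_mul hδ fun c => hN fun i => X i c

lemma norm_le_frob (X : Fin n → Vec m) (i : Fin n) : ‖X i‖ ≤ frob X := by
  rw [frob_eq_l2_norm, l2_eq_sqrt]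
  refine Real.le_sqrt_of_sq_le ?_
  exact Finset.single_le_sum (f := fun j => ‖X j‖ ^ 2) (fun j _ => sq_nonneg _)
    (Finset.mem_univ i)

lemma norm_sub_le_frob (X : Fin n → Vec m) (i j : Fin n) :
    ‖X i - X j‖ ≤ Real.sqrt 2 * frob X := by
  rcases eq_or_ne i j with rfl | hij
  · simpa using frob_nonneg X
  have hs : ‖X i‖ ^ 2 + ‖X j‖ ^ 2 ≤ ∑ l, ‖X l‖ ^ 2 := by
    rw [← Finset.sum_pair (f := fun l => ‖X l‖ ^ 2) hij]
    exact Finset.sum_le_sum_of_subset_of_nonneg (Finset.subset_univ _) fun l _ _ => sq_nonneg _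
  rw [frob_eq_l2_norm, l2_eq_sqrt, ← Real.sqrt_mul (by norm_num)]
  refine Real.le_sqrt_of_sq_le ?_
  have h1 : ‖X i - X j‖ ^ 2 ≤ (‖X i‖ + ‖X j‖) ^ 2 := by gcongr; exact norm_sub_le _ _
  nlinarith [sq_nonneg (‖X i‖ - ‖X j‖)]

lemma sum_norm_le_frob (X : Fin n → Vec m) : ∑ i, ‖X i‖ ≤ Real.sqrt n * frob X := by
  have := sum_abs_le_l2 fun i => ‖X i‖
  rw [← frob_eq_l2_norm] at this
  simpa using this

lemma frob_le_of_supNorm_le {X : Fin n → Vec m} {b : ℝ} (hb : 0 ≤ b)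
    (h : ∀ i, supNorm (X i) ≤ b) : frob X ≤ Real.sqrt (m * n) * b := by
  rw [frob_eq_l2_norm]
  have : ∀ i, ‖X i‖ ≤ Real.sqrt m * b := fun i =>
    (norm_le_sqrt_mul_supNorm _).trans (by gcongr; exact h i)
  refine (l2_le_of_le (fun i => norm_nonneg _) this).trans (le_of_eq ?_)
  rw [l2_const (by positivity), Real.sqrt_mul (by positivity)]
  simp
  ring

lemma frob_le_mul_frob_of_norm_le {X Y : Fin n → Vec m} {a : ℝ} (ha : 0 ≤ a)
    (h : ∀ i, ‖X i‖ ≤ a * ‖Y i‖) : frob X ≤ a * frob Y := by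
  rw [frob_eq_l2_norm, frob_eq_l2_norm, ← abs_of_nonneg ha, ← l2_smul]
  exact l2_le_of_le (fun i => norm_nonneg _) fun i => by simpa [abs_of_nonneg ha] using h i

lemma frob_act_le (M : Matrix (Fin n) (Fin n) ℝ) (X : Fin n → Vec m) :
    frob (act M X) ≤ l2op M * frob X :=
  colN_act_le (l2op_nonneg M) (fun v => l2_mulVec_le M v) X

/-- Column-stochastic matrices do not increase the `ℓ¹` norm. -/
lemma frob_act_le_of_column_stochastic {B : Matrix (Fin n) (Fin n) ℝ} (hB0 : ∀ i j, 0 ≤ B i j)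
    (hB : ∀ j, ∑ i, B i j = 1) {X : Fin n → Vec m} {b : ℝ}
    (h : ∀ i, supNorm (X i) ≤ b) : frob (act B X) ≤ n * Real.sqrt m * b := by
  have hX : ∀ i, ‖X i‖ ≤ Real.sqrt m * b := fun i =>
    (norm_le_sqrt_mul_supNorm _).trans (by gcongr; exact h i)
  rw [frob_eq_l2_norm]
  refine (l2_le_sum_abs _).trans ?_
  calc ∑ i, |‖act B X i‖| ≤ ∑ i, ∑ j, B i j * ‖X j‖ := by
        refine Finset.sum_le_sum fun i _ => ?_
        rw [abs_norm, act_apply]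
        refine (norm_sum_le _ _).trans (le_of_eq (Finset.sum_congr rfl fun j _ => ?_))
        rw [norm_smul, Real.norm_of_nonneg (hB0 i j)]
    _ = ∑ j, ‖X j‖ := by
        rw [Finset.sum_comm]
        simp_rw [← Finset.sum_mul, hB, one_mul]
    _ ≤ ∑ _j : Fin n, Real.sqrt m * b := Finset.sum_le_sum fun j _ => hX j
    _ = n * Real.sqrt m * b := by simp; ring

lemma norm_sum_smul_le_frob (v : Fin n → ℝ) (X : Fin n → Vec m) :
    ‖∑ i, v i • X i‖ ≤ l2 v * frob X := by
  have h : ‖∑ i, v i • X i‖ ≤ ∑ i, |v i| * ‖X i‖ := by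
    refine (norm_sum_le _ _).trans (le_of_eq ?_)
    simp [norm_smul]
  have h2 := abs_dotProduct_le_l2 (fun i => |v i|) (fun i => ‖X i‖)
  have h3 : l2 (fun i => |v i|) = l2 v := by simp [l2_eq_sqrt]
  rw [h3, ← frob_eq_l2_norm] at h2
  exact h.trans ((le_abs_self _).trans h2)

end colN

/-! ### Quantization error -/

lemma abs_quant_sub_le {K : ℕ} {u : ℝ} (hu : |u| ≤ K + 1 / 2) : |quant K u - u| ≤ 1 / 2 := by
  have key : ∀ w : ℝ, 0 ≤ w → w ≤ K + 1 / 2 →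
      |((min ⌊w + 1 / 2⌋ (K : ℤ) : ℤ) : ℝ) - w| ≤ 1 / 2 := by
    intro w hw hwK
    have h1 := Int.floor_le (w + 1 / 2)
    have h2 := Int.lt_floor_add_one (w + 1 / 2)
    rcases le_total ⌊w + 1 / 2⌋ (K : ℤ) with h | h
    · rw [min_eq_left h, abs_le]
      constructor <;> linarith
    -- Clipping is active only if w ≥ K - 1/2; together with w ≤ K + 1/2 this leaves w within 1/2 of
    -- K.
    · rw [min_eq_right h, abs_le]
      have h3 : ((K : ℤ) : ℝ) ≤ (⌊w + 1 / 2⌋ : ℝ) := by exact_mod_cast h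
      push_cast at h3 ⊢
      constructor <;> linarith
  rw [abs_le] at hu
  unfold quant
  split_ifs with h
  · exact key u h hu.2
  · have := key (-u) (by linarith) (by linarith)
    rw [← abs_neg] at this
    convert this using 2
    ring

lemma supNorm_Quant_sub_le {m K : ℕ} {u : Vec m} (hu : ¬ Saturates K u) :
    supNorm (Quant K u - u) ≤ 1 / 2 := by
  rw [supNorm_le_iff (by norm_num)]
  intro c
  exact abs_quant_sub_le ((abs_le_supNorm u c).trans (not_lt.1 hu))

/-! ### Gradient descent for strongly convex smooth functions -/

section gradient

variable {V : Type*} [NormedAddCommGroup V] [InnerProductSpace ℝ V] [CompleteSpace V]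

/-- A function with `L`-Lipschitz gradient lies below its quadratic upper models. -/
lemma le_quadratic_of_gradient_lipschitz {F : V → ℝ} {L : ℝ} (hF : Differentiable ℝ F)
    (hL : ∀ x y, ‖gradient F x - gradient F y‖ ≤ L * ‖x - y‖) (x v : V) :
    F (x + v) ≤ F x + inner ℝ (gradient F x) v + L / 2 * ‖v‖ ^ 2 := by
  -- Up to the constant `F x`, this is `F` minus its quadratic model along the segment; the
  -- Lipschitz bound makes its derivative nonpositive.
  let φ : ℝ → ℝ := fun s => F (x + s • v) - s * inner ℝ (gradient F x) v - L / 2 * s ^ 2 * ‖v‖ ^ 2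
  have hline : ∀ s : ℝ, HasDerivAt (fun s : ℝ => x + s • v) v s := fun s => by
    simpa using ((hasDerivAt_id s).smul_const v).const_add x
  have hd : ∀ s, HasDerivAt φ (inner ℝ (gradient F (x + s • v)) v - inner ℝ (gradient F x) v
      - L * s * ‖v‖ ^ 2) s := fun s => by
    have h1 := ((hF (x + s • v)).hasGradientAt.hasFDerivAt).comp_hasDerivAt s (hline s)
    have h2 := (hasDerivAt_id s).mul_const (inner ℝ (gradient F x) v)
    have h3 := (((hasDerivAt_id s).pow 2).const_mul (L / 2)).mul_const (‖v‖ ^ 2)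
    refine HasDerivAt.congr_deriv (f := φ) ((h1.sub h2).sub h3) ?_
    simp only [InnerProductSpace.toDual_apply_apply, id]
    push_cast
    ring
  have hanti : AntitoneOn φ (Set.Icc 0 1) := by
    refine antitoneOn_of_deriv_nonpos (convex_Icc 0 1)
      (fun s _ => (hd s).continuousAt.continuousWithinAt)
      (fun s _ => (hd s).differentiableAt.differentiableWithinAt) fun s hs => ?_
    rw [interior_Icc] at hs
    rw [(hd s).deriv, ← inner_sub_left, sub_nonpos]
    refine (real_inner_le_norm _ _).trans ?_
    have := hL (x + s • v) x
    rw [add_sub_cancel_left, norm_smul, Real.norm_of_nonneg hs.1.le] at this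
    calc _ ≤ L * (s * ‖v‖) * ‖v‖ := by gcongr
      _ = _ := by ring
  have := hanti (Set.left_mem_Icc.2 zero_le_one) (Set.right_mem_Icc.2 zero_le_one) zero_le_one
  simp only [φ, one_smul, zero_smul, add_zero] at this
  linarith

/-- Co-coercivity of the gradient of a strongly convex smooth function. -/
lemma norm_sq_gradient_sub_le {F : V → ℝ} {μ L : ℝ} (hμL : μ ≤ L) (hF : Differentiable ℝ F)
    (hμ : ∀ x y, F x + inner ℝ (gradient F x) (y - x) + μ / 2 * ‖x - y‖ ^ 2 ≤ F y)
    (hL : ∀ x y, ‖gradient F x - gradient F y‖ ≤ L * ‖x - y‖) (x y : V) :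
    ‖gradient F x - gradient F y - μ • (x - y)‖ ^ 2
      ≤ (L - μ) * inner ℝ (gradient F x - gradient F y - μ • (x - y)) (x - y) := by
  -- Evaluate `F` at the trial point x - s u: strong convexity at y bounds it from below, the
  -- quadratic model at x from above.
  have one_sided : ∀ (x y : V) (s : ℝ),
      F y + inner ℝ (gradient F y) (x - y) + μ / 2 * ‖x - y‖ ^ 2
        + (s - (L - μ) / 2 * s ^ 2) * ‖gradient F x - gradient F y - μ • (x - y)‖ ^ 2 ≤ F x := by
    intro x y s
    set u := gradient F x - gradient F y - μ • (x - y) with hu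
    have h1 := hμ y (x + (-s) • u)
    have h2 := le_quadratic_of_gradient_lipschitz hF hL x ((-s) • u)
    have e1 : x + (-s) • u - y = (x - y) + (-s) • u := by abel
    have e2 : ‖y - (x + (-s) • u)‖ ^ 2
        = ‖x - y‖ ^ 2 - 2 * s * inner ℝ (x - y) u + s ^ 2 * ‖u‖ ^ 2 := by
      rw [norm_sub_rev, e1, norm_add_sq_real, inner_smul_right, norm_smul, mul_pow]
      simp
      ring
    have e3 : inner ℝ (gradient F x) u = ‖u‖ ^ 2 + inner ℝ (gradient F y) u
        + μ * inner ℝ (x - y) u := by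
      have : gradient F x = u + gradient F y + μ • (x - y) := by rw [hu]; abel
      rw [this, inner_add_left, inner_add_left, inner_smul_left, real_inner_self_eq_norm_sq]
      simp
    rw [e1, e2, inner_add_right, inner_smul_right] at h1
    rw [inner_smul_right, e3, norm_smul, mul_pow, Real.norm_eq_abs, sq_abs] at h2
    nlinarith
  set u := gradient F x - gradient F y - μ • (x - y) with hu
  -- Adding `one_sided` for (x, y) and (y, x) cancels the function values. The best choice is s =
  -- 1/(L-μ); if L = μ, letting s be arbitrarily large forces u = 0.
  have hs : ∀ s : ℝ, (2 * s - (L - μ) * s ^ 2) * ‖u‖ ^ 2 ≤ inner ℝ u (x - y) := by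
    intro s
    have h1 := one_sided x y s
    have h2 := one_sided y x s
    have e : gradient F y - gradient F x - μ • (y - x) = -u := by
      rw [hu, smul_sub, smul_sub]; abel
    rw [e, norm_neg, norm_sub_rev y x] at h2
    rw [← hu] at h1
    have e2 : inner ℝ u (x - y) = inner ℝ (gradient F x) (x - y) - inner ℝ (gradient F y) (x - y)
        - μ * ‖x - y‖ ^ 2 := by
      rw [hu, inner_sub_left, inner_sub_left, inner_smul_left, real_inner_self_eq_norm_sq]
      simp
    have e3 : inner ℝ (gradient F x) (y - x) = - inner ℝ (gradient F x) (x - y) := by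
      rw [← inner_neg_right, neg_sub]
    rw [e3] at h2
    rw [e2]
    linarith
  rcases hμL.eq_or_lt with h | h
  · rw [h, sub_self, zero_mul]
    rw [h, sub_self] at hs
    by_contra! hpos
    have := hs ((inner ℝ u (x - y) + 1) / ‖u‖ ^ 2)
    rw [zero_mul, sub_zero, mul_assoc, div_mul_cancel₀ _ hpos.ne'] at this
    have h0 := hs 0
    simp at h0
    linarith
  · have hM : 0 < L - μ := sub_pos.2 h
    have := hs (1 / (L - μ))
    have e : 2 * (1 / (L - μ)) - (L - μ) * (1 / (L - μ)) ^ 2 = 1 / (L - μ) := by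
      field_simp; ring
    rw [e, one_div, inv_mul_le_iff₀ hM] at this
    exact this

/-- A gradient step is a contraction with factor `1 - tμ`. -/
lemma norm_gradient_step_le {F : V → ℝ} {μ L t : ℝ} (hμL : μ ≤ L) (hL0 : 0 ≤ L)
    (hF : Differentiable ℝ F)
    (hμ : ∀ x y, F x + inner ℝ (gradient F x) (y - x) + μ / 2 * ‖x - y‖ ^ 2 ≤ F y)
    (hL : ∀ x y, ‖gradient F x - gradient F y‖ ≤ L * ‖x - y‖)
    (ht : 0 ≤ t) (htL : t * (μ + L) ≤ 1) (x y : V) :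
    ‖x - y - t • (gradient F x - gradient F y)‖ ≤ (1 - t * μ) * ‖x - y‖ := by
  have hc := norm_sq_gradient_sub_le hμL hF hμ hL x y
  set u := gradient F x - gradient F y - μ • (x - y) with hu
  have e : x - y - t • (gradient F x - gradient F y) = (1 - t * μ) • (x - y) - t • u := by
    rw [hu]; module
  have htμ : 0 ≤ 1 - t * μ := by linarith [mul_nonneg ht hL0]
  have hud : 0 ≤ inner ℝ u (x - y) := by
    rcases hμL.eq_or_lt with h | h
    · rw [h, sub_self, zero_mul] at hc
      have : u = 0 := by
        have := le_antisymm hc (sq_nonneg _)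
        simpa using this
      simp [this]
    · have : 0 ≤ (L - μ) * inner ℝ u (x - y) := (sq_nonneg _).trans hc
      exact nonneg_of_mul_nonneg_right this (sub_pos.2 h)
  rw [e]
  refine abs_le_of_sq_le_sq' ?_ (by positivity) |>.2
  rw [norm_sub_sq_real, inner_smul_left, inner_smul_right, norm_smul, norm_smul, mul_pow, mul_pow,
    Real.norm_eq_abs, Real.norm_eq_abs, sq_abs, sq_abs, real_inner_comm]
  simp only [conj_trivial]
  -- By co-coercivity the terms containing u contribute at most -t(2 - t(μ+L))⟨u, x-y⟩ to the
  -- square, which is nonpositive.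
  have h1 : t ^ 2 * ‖u‖ ^ 2 ≤ t ^ 2 * ((L - μ) * inner ℝ u (x - y)) := by gcongr
  have h2 : 0 ≤ (t * inner ℝ u (x - y)) * (2 - t * (μ + L)) :=
    mul_nonneg (mul_nonneg ht hud) (by linarith)
  rw [mul_pow]
  nlinarith

end gradient

/-! ### Admissible data, projections and averages -/

namespace Params

variable {n m : ℕ}

/-- The standing assumptions on the data, with minimizer `xs`. -/
structure Admissible (D : Params n m) (xs : Vec m) : Prop where
  n_pos : 0 < n
  m_pos : 0 < m
  A_nonneg : ∀ i j, 0 ≤ D.A i j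
  A_row : ∀ i, ∑ j, D.A i j = 1
  B_nonneg : ∀ i j, 0 ≤ D.B i j
  B_col : ∀ j, ∑ i, D.B i j = 1
  α_mem : D.α ∈ Set.Ioo (0 : ℝ) 1
  β_mem : D.β ∈ Set.Ioo (0 : ℝ) 1
  μ_pos : 0 < D.μ
  L_pos : 0 < D.L
  diff : ∀ i, Differentiable ℝ (D.f i)
  convex : ∀ i x y,
    D.f i x + inner ℝ (gradient (D.f i) x) (y - x) + D.μ / 2 * ‖x - y‖ ^ 2 ≤ D.f i y
  smooth : ∀ i x y, ‖gradient (D.f i) x - gradient (D.f i) y‖ ≤ D.L * ‖x - y‖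
  isMin : ∀ x, ∑ i, D.f i xs ≤ ∑ i, D.f i x
  πA_nonneg : ∀ i, 0 ≤ D.πA i
  πA_sum : ∑ i, D.πA i = 1
  πA_eq : D.πA ᵥ* D.A = D.πA
  πB_nonneg : ∀ i, 0 ≤ D.πB i
  πB_sum : ∑ i, D.πB i = 1
  πB_eq : D.B *ᵥ D.πB = D.πB
  l2_le_NA : ∀ v, l2 v ≤ D.NA v
  l2_le_NB : ∀ v, l2 v ≤ D.NB v
  σA_lt : D.σA < 1
  σB_lt : D.σB < 1
  δAB_pos : 0 < D.δAB
  NA_le_NB : ∀ v, D.NA v ≤ D.δAB * D.NB v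
  δA2_pos : 0 < D.δA2
  NA_le_l2 : ∀ v, D.NA v ≤ D.δA2 * l2 v
  δB2_pos : 0 < D.δB2
  NB_le_l2 : ∀ v, D.NB v ≤ D.δB2 * l2 v
  stepRange : D.StepRange

/-- The projection `I - 1 π_Aᵀ` onto the disagreement. -/
def RA (D : Params n m) : Matrix (Fin n) (Fin n) ℝ := 1 - Matrix.vecMulVec 1 D.πA

/-- The projection `I - π_B 1ᵀ`. -/
def RB (D : Params n m) : Matrix (Fin n) (Fin n) ℝ := 1 - Matrix.vecMulVec D.πB 1

/-- The weighted average `π_Aᵀ x`. -/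
def avg (D : Params n m) (x : Fin n → Vec m) : Vec m := ∑ i, D.πA i • x i

/-- The local gradients at the local states. -/
def grads (D : Params n m) (x : Fin n → Vec m) : Fin n → Vec m := fun i => gradient (D.f i) (x i)

variable {D : Params n m} {xs : Vec m}

lemma act_RA_apply (x : Fin n → Vec m) (i : Fin n) : act D.RA x i = x i - D.avg x := by
  rw [RA, act_sub_left, act_one, Pi.sub_apply, act_vecMulVec]
  simp [avg]

lemma act_RB_apply (z : Fin n → Vec m) (i : Fin n) :
    act D.RB z i = z i - D.πB i • ∑ j, z j := by
  rw [RB, act_sub_left, act_one, Pi.sub_apply, act_vecMulVec]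
  simp

lemma eq_smul_sum_add_act_RB (z : Fin n → Vec m) :
     z = (fun i => D.πB i • ∑ j, z j) + act D.RB z := by
  ext1 i
  simp [act_RB_apply]

lemma avg_eq_smul_sum_add (z : Fin n → Vec m) :
     D.avg z = D.ππ • ∑ i, z i + ∑ i, D.πA i • act D.RB z i := by
  simp [avg, act_RB_apply, smul_sub, Finset.sum_sub_distrib, smul_smul, ← Finset.sum_smul, ππ,
    dotProduct]

lemma Θ_eq (x z : Fin n → Vec m) :
    D.Θ xs x z = ![‖D.avg x - xs‖, colN D.NA (act D.RA x), colN D.NB (act D.RB z)] := by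
  have h1 : (fun i => x i - ∑ j, D.πA j • x j) = act D.RA x := by
    ext1 i; rw [act_RA_apply, avg]
  have h2 : (fun i => z i - D.πB i • ∑ j, z j) = act D.RB z := by
    ext1 i; rw [act_RB_apply]
  rw [Θ, h1, h2, avg]

namespace Admissible

/-! #### Signs of the constants -/

lemma η_nonneg (H : D.Admissible xs) : 0 ≤ D.η := H.stepRange.1

lemma ππ_nonneg (H : D.Admissible xs) : 0 ≤ D.ππ := by
  unfold ππ dotProduct
  exact Finset.sum_nonneg fun i _ => mul_nonneg (H.πA_nonneg i) (H.πB_nonneg i)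

lemma ηt_nonneg (H : D.Admissible xs) : 0 ≤ D.ηt := mul_nonneg H.η_nonneg H.ππ_nonneg

/-- Used to absorb a factor ξ < 1 into `δA2` in the third entry of the perturbation. -/
lemma one_le_δA2 (H : D.Admissible xs) : 1 ≤ D.δA2 := by
  have hpos : 0 < l2 (1 : Fin n → ℝ) := by
    have : l2 (1 : Fin n → ℝ) = Real.sqrt n := by
      have := l2_const (ι := Fin n) (zero_le_one (α := ℝ))
      simpa [Pi.one_def] using this
    rw [this]
    exact Real.sqrt_pos.2 (by exact_mod_cast H.n_pos)
  have := (H.l2_le_NA 1).trans (H.NA_le_l2 1)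
  by_contra! hlt
  nlinarith

lemma l2_πA_le_one (H : D.Admissible xs) : l2 D.πA ≤ 1 := by
  refine (l2_le_sum_abs _).trans (le_of_eq ?_)
  rw [← H.πA_sum]
  exact Finset.sum_congr rfl fun i _ => abs_of_nonneg (H.πA_nonneg i)

/-- Cauchy–Schwarz, with ‖πA‖₂ ≤ ‖πA‖₁ = 1. -/
lemma ππ_le_κ2 (H : D.Admissible xs) : D.ππ ≤ D.κ2 := by
  calc D.ππ ≤ l2 D.πA * l2 D.πB := (le_abs_self _).trans (abs_dotProduct_le_l2 _ _)
    _ ≤ 1 * l2 D.πB := mul_le_mul_of_nonneg_right H.l2_πA_le_one (l2_nonneg _)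
    _ ≤ D.κ2 := by rw [one_mul]; exact H.l2_le_NA _

/-- For n ≥ 2 the kernel of `πA` contains a nonzero vector, and the projection fixes it. -/
lemma one_le_κ1 (H : D.Admissible xs) (hn : 2 ≤ n) : 1 ≤ D.κ1 := by
  obtain ⟨i, j, hij⟩ : ∃ i j : Fin n, i ≠ j :=
    ⟨⟨0, by omega⟩, ⟨1, by omega⟩, by simp⟩
  have key : ∀ v : Fin n → ℝ, D.πA ⬝ᵥ v = 0 → v ≠ 0 → 1 ≤ D.κ1 := fun v hv hv0 => by
    refine one_le_opN_of_mulVec_eq H.l2_le_NA H.δA2_pos H.NA_le_l2 hv0 ?_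
    rw [Matrix.sub_mulVec, Matrix.one_mulVec, Matrix.vecMulVec_mulVec, hv]
    simp
  by_cases hi : D.πA i = 0
  · refine key (Pi.single i 1) (by simp [hi]) (by simp)
  · refine key (D.πA j • Pi.single i 1 - D.πA i • Pi.single j 1) (by simp; ring) fun h => hi ?_
    have := congrFun h j
    simpa [hij.symm] using this

/-- Add the two strong convexity inequalities for a pair of points at distance 1, which exists
because m > 0. -/
lemma μ_le_L (H : D.Admissible xs) : D.μ ≤ D.L := by
  let v : Vec m := EuclideanSpace.single ⟨0, H.m_pos⟩ 1
  have hv : ‖v‖ = 1 := by simp [v]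
  let i : Fin n := ⟨0, H.n_pos⟩
  have h1 := H.convex i 0 v
  have h2 := H.convex i v 0
  have h3 := (real_inner_le_norm (gradient (D.f i) v - gradient (D.f i) 0) v).trans
    (mul_le_mul_of_nonneg_right (H.smooth i v 0) (norm_nonneg v))
  rw [inner_sub_left] at h3
  simp only [zero_sub, sub_zero, norm_neg, hv, inner_neg_right] at h1 h2 h3
  linarith

/-- The total cost is nμ-strongly convex and nL-smooth, and this is the condition under which its
gradient step contracts. For n = 1 it is the first step-size bound. For n ≥ 2 the last bound gives η
Γ2 ≤ Γ3; keeping only the third summand of `Γ2` yields ηt · nL ≤ 1/4, and μ ≤ L does the rest. -/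
lemma ηt_mul_le_one (H : D.Admissible xs) : D.ηt * (n * D.μ + n * D.L) ≤ 1 := by
  obtain ⟨hη, h1, -, -, h4⟩ := H.stepRange
  rcases Nat.lt_or_ge n 2 with hn | hn
  · have : n = 1 := by have := H.n_pos; omega
    subst this
    rw [ηt]
    push_cast
    linarith
  have hκ1 := H.one_le_κ1 hn
  have hκ2 := H.ππ_le_κ2
  have hπ := H.ππ_nonneg
  have hσA : 0 ≤ D.σA := opN_nonneg _
  have hσA' : 0 < 1 - D.σA := sub_pos.2 H.σA_lt
  have hσB' : 0 < 1 - D.σB := sub_pos.2 H.σB_lt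
  have hκ3 : 0 ≤ D.κ3 := opN_nonneg _
  have hκ4 : 0 ≤ D.κ4 := l2op_nonneg _
  have hκ5 : 0 ≤ D.κ5 := l2_nonneg _
  have hκ6 : 0 ≤ D.κ6 := l2_nonneg _
  have hκ1' : 0 ≤ D.κ1 := opN_nonneg _
  have hκ2' : 0 ≤ D.κ2 := apply_nonneg _ _
  have hL := H.L_pos
  have hμ := H.μ_pos
  have hAB := H.δAB_pos
  have hB2 := H.δB2_pos
  have hn1 : (1 : ℝ) ≤ n := by exact_mod_cast H.n_pos
  have hsn : 1 ≤ Real.sqrt n := Real.one_le_sqrt.2 hn1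
  have hΓ1 : 0 ≤ D.Γ1 := by unfold Γ1; positivity
  have hΓ3 : 0 ≤ D.Γ3 := by unfold Γ3; positivity
  have hΓ2 : n * Real.sqrt n * D.L ^ 2 * D.ππ * D.κ1 * D.κ2 * (1 - D.σB) ≤ D.Γ2 := by
    have e1 : 0 ≤ D.δB2 * n * D.L ^ 2 * D.κ1 * D.κ2 * D.κ3 * D.κ4 * D.κ6 := by positivity
    have e2 : 0 ≤ D.δB2 * n * D.L ^ 2 * D.κ3 * D.κ5 * D.κ6 * (1 - D.σA) := by positivity
    have e3 : 0 ≤ D.δAB * D.δB2 * D.L * D.ππ * D.μ * D.κ1 * D.κ3 * D.κ4 := by positivity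
    unfold Γ2
    linarith
  have hsq : D.Γ2 ≤ Real.sqrt (D.Γ2 ^ 2 + 4 * D.Γ1 * D.Γ3) :=
    Real.le_sqrt_of_sq_le (by nlinarith [mul_nonneg hΓ1 hΓ3])
  have h5 : D.η * D.Γ2 ≤ D.Γ3 := by nlinarith [mul_le_mul_of_nonneg_left hsq hη]
  rcases hπ.eq_or_lt with h0 | hpos
  · simp [ηt, ← h0]
  have hmono : 1 * 1 * D.ππ ≤ Real.sqrt n * D.κ1 * D.κ2 := by gcongr
  -- The factor `ππ` (1 - σB) is carried along to be cancelled. Replacing √n κ1 κ2 by its lower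
  -- bound `ππ` turns η into `ηt`.
  have h6 : (D.ππ * (1 - D.σB)) * (D.η * (n * D.L ^ 2 * D.ππ))
      ≤ (D.ππ * (1 - D.σB)) * (D.μ / 4) := by
    calc (D.ππ * (1 - D.σB)) * (D.η * (n * D.L ^ 2 * D.ππ))
        = D.η * (n * D.L ^ 2 * D.ππ * (1 - D.σB)) * (1 * 1 * D.ππ) := by ring
      _ ≤ D.η * (n * D.L ^ 2 * D.ππ * (1 - D.σB)) * (Real.sqrt n * D.κ1 * D.κ2) := by
          gcongr
      _ = D.η * (n * Real.sqrt n * D.L ^ 2 * D.ππ * D.κ1 * D.κ2 * (1 - D.σB)) := by ring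
      _ ≤ D.η * D.Γ2 := by gcongr
      _ ≤ D.Γ3 := h5
      _ = (D.ππ * (1 - D.σB)) * (D.μ / 4) * (1 - D.σA) := by unfold Γ3; ring
      _ ≤ (D.ππ * (1 - D.σB)) * (D.μ / 4) * 1 := by gcongr; linarith
      _ = _ := mul_one _
  have h7 := le_of_mul_le_mul_left h6 (by positivity)
  have hμL := H.μ_le_L
  have h8 : D.L * (D.ηt * (n * D.L)) ≤ D.L * (1 / 4) := by
    rw [ηt]; nlinarith
  have h9 := le_of_mul_le_mul_left h8 hL
  have h10 : D.ηt * (n * D.μ) ≤ D.ηt * (n * D.L) :=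
    mul_le_mul_of_nonneg_left (by gcongr) H.ηt_nonneg
  linarith

/-! #### Matrix identities -/

lemma Aα_mulVec_one (H : D.Admissible xs) : D.Aα *ᵥ 1 = 1 := by
  have : D.A *ᵥ 1 = 1 := by ext i; simpa [Matrix.mulVec, dotProduct] using H.A_row i
  rw [Aα, Matrix.add_mulVec, Matrix.smul_mulVec, Matrix.smul_mulVec, this, Matrix.one_mulVec,
    ← add_smul, sub_add_cancel, one_smul]

lemma πA_vecMul_Aα (H : D.Admissible xs) : D.πA ᵥ* D.Aα = D.πA := by
  rw [Aα, Matrix.vecMul_add, Matrix.vecMul_smul, Matrix.vecMul_smul, H.πA_eq, Matrix.vecMul_one,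
    ← add_smul, sub_add_cancel, one_smul]

lemma Bβ_mulVec_πB (H : D.Admissible xs) : D.Bβ *ᵥ D.πB = D.πB := by
  rw [Bβ, Matrix.add_mulVec, Matrix.smul_mulVec, Matrix.smul_mulVec, H.πB_eq, Matrix.one_mulVec,
    ← add_smul, sub_add_cancel, one_smul]

lemma one_vecMul_Bβ (H : D.Admissible xs) : 1 ᵥ* D.Bβ = 1 := by
  have : 1 ᵥ* D.B = 1 := by ext i; simpa [Matrix.vecMul, dotProduct] using H.B_col i
  rw [Bβ, Matrix.vecMul_add, Matrix.vecMul_smul, Matrix.vecMul_smul, this, Matrix.vecMul_one,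
    ← add_smul, sub_add_cancel, one_smul]

lemma πA_dot_one (H : D.Admissible xs) : D.πA ⬝ᵥ 1 = 1 := by simpa [dotProduct] using H.πA_sum

/-- Both sides equal `Aα` - 1 πAᵀ, because `Aα` fixes 1 on the right and πAᵀ on the left. Hence the
disagreement evolves by a matrix of norm `σA`. -/
lemma RA_mul_Aα (H : D.Admissible xs) : D.RA * D.Aα = (D.Aα - Matrix.vecMulVec 1 D.πA) * D.RA := by
  simp only [RA, sub_mul, mul_sub, one_mul, mul_one, Matrix.vecMulVec_mul, Matrix.mul_vecMulVec,
    Matrix.vecMulVec_mulVec, H.πA_vecMul_Aα, H.Aα_mulVec_one, H.πA_dot_one]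
  simp

/-- Encoding errors of the states enter the disagreement without a factor `κ1`. -/
lemma RA_mul_Aα_sub_one (H : D.Admissible xs) : D.RA * (D.Aα - 1) = D.Aα - 1 := by
  simp only [RA, sub_mul, mul_sub, one_mul, mul_one, Matrix.vecMulVec_mul, H.πA_vecMul_Aα]
  simp

/-- The consensus part of the states does not cause any movement, so ‖x' - x‖ can be bounded by the
disagreement. -/
lemma Aα_sub_one_mul_RA (H : D.Admissible xs) : (D.Aα - 1) * D.RA = D.Aα - 1 := by
  simp only [RA, sub_mul, mul_sub, one_mul, mul_one, Matrix.mul_vecMulVec, H.Aα_mulVec_one]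
  simp

lemma RB_mul_Bβ (H : D.Admissible xs) : D.RB * D.Bβ = (D.Bβ - Matrix.vecMulVec D.πB 1) * D.RB := by
  have h1 : (1 : Fin n → ℝ) ⬝ᵥ D.πB = 1 := by simpa [dotProduct] using H.πB_sum
  simp only [RB, sub_mul, mul_sub, one_mul, mul_one, Matrix.vecMulVec_mul, Matrix.mul_vecMulVec,
    Matrix.vecMulVec_mulVec, H.one_vecMul_Bβ, H.Bβ_mulVec_πB, h1]
  simp

/-! #### Gradients -/

lemma gradient_sum (H : D.Admissible xs) (x : Vec m) :
    gradient (fun x => ∑ i, D.f i x) x = ∑ i, gradient (D.f i) x := by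
  refine HasGradientAt.gradient ?_
  rw [hasGradientAt_iff_hasFDerivAt, map_sum]
  exact HasFDerivAt.fun_sum fun i _ => (H.diff i x).hasGradientAt.hasFDerivAt

lemma sum_gradient_eq_zero (H : D.Admissible xs) : ∑ i, gradient (D.f i) xs = 0 := by
  rw [← H.gradient_sum, gradient, IsLocalMin.fderiv_eq_zero (Filter.Eventually.of_forall H.isMin),
    map_zero]

lemma norm_avg_step_le (H : D.Admissible xs) (x : Vec m) :
    ‖x - xs - D.ηt • ∑ i, gradient (D.f i) x‖ ≤ (1 - D.ηt * D.μ) * ‖x - xs‖ := by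
  have hn1 : (1 : ℝ) ≤ n := by exact_mod_cast H.n_pos
  have h := norm_gradient_step_le (F := fun x => ∑ i, D.f i x) (μ := n * D.μ) (L := n * D.L)
    (t := D.ηt) (mul_le_mul_of_nonneg_left H.μ_le_L (by positivity))
    (mul_nonneg (by positivity) H.L_pos.le)
    (Differentiable.fun_sum fun i _ => H.diff i)
    (fun x y => by
      rw [H.gradient_sum, sum_inner]
      have := Finset.sum_le_sum fun i (_ : i ∈ Finset.univ) => H.convex i x y
      rw [Finset.sum_add_distrib, Finset.sum_add_distrib] at this
      simp only [Finset.sum_const, Finset.card_univ, Fintype.card_fin, nsmul_eq_mul] at this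
      linarith)
    (fun x y => by
      rw [H.gradient_sum, H.gradient_sum, ← Finset.sum_sub_distrib]
      refine (norm_sum_le _ _).trans ?_
      refine (Finset.sum_le_sum fun i _ => H.smooth i x y).trans (le_of_eq ?_)
      simp [mul_assoc])
    H.ηt_nonneg H.ηt_mul_le_one x xs
  rw [H.gradient_sum, H.gradient_sum, H.sum_gradient_eq_zero, sub_zero] at h
  refine h.trans (mul_le_mul_of_nonneg_right ?_ (norm_nonneg _))
  -- The contraction factor obtained is 1 - nμ ηt; it is weakened to the entry 1 - μ ηt of `G`.
  have : D.ηt * D.μ * 1 ≤ D.ηt * D.μ * n :=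
    mul_le_mul_of_nonneg_left hn1 (mul_nonneg H.ηt_nonneg H.μ_pos.le)
  linarith

lemma norm_sum_grads_sub_le (H : D.Admissible xs) (x : Fin n → Vec m) :
    ‖∑ i, gradient (D.f i) (D.avg x) - ∑ i, D.grads x i‖
      ≤ Real.sqrt n * D.L * colN D.NA (act D.RA x) := by
  rw [← Finset.sum_sub_distrib]
  calc ‖∑ i, (gradient (D.f i) (D.avg x) - D.grads x i)‖
      ≤ ∑ i, D.L * ‖act D.RA x i‖ := by
        refine (norm_sum_le _ _).trans (Finset.sum_le_sum fun i _ => ?_)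
        rw [act_RA_apply, norm_sub_rev (x i)]
        exact H.smooth i _ _
    _ = D.L * ∑ i, ‖act D.RA x i‖ := by rw [Finset.mul_sum]
    _ ≤ D.L * (Real.sqrt n * colN D.NA (act D.RA x)) := by
        have := H.L_pos
        gcongr
        refine (sum_norm_le_frob _).trans ?_
        gcongr
        exact frob_le_colN H.l2_le_NA _
    _ = _ := by ring

lemma norm_sum_grads_le (H : D.Admissible xs) (x : Fin n → Vec m) :
    ‖∑ i, D.grads x i‖
      ≤ Real.sqrt n * D.L * colN D.NA (act D.RA x) + n * D.L * ‖D.avg x - xs‖ := by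
  have h1 := H.norm_sum_grads_sub_le x
  have h2 : ‖∑ i, gradient (D.f i) (D.avg x)‖ ≤ n * D.L * ‖D.avg x - xs‖ := by
    rw [← sub_zero (∑ i, gradient (D.f i) (D.avg x)), ← H.sum_gradient_eq_zero,
      ← Finset.sum_sub_distrib]
    refine (norm_sum_le _ _).trans ?_
    refine (Finset.sum_le_sum fun i _ => H.smooth i _ _).trans (le_of_eq ?_)
    simp [mul_assoc]
  rw [norm_sub_rev] at h1
  calc ‖∑ i, D.grads x i‖ = ‖(∑ i, D.grads x i - ∑ i, gradient (D.f i) (D.avg x))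
        + ∑ i, gradient (D.f i) (D.avg x)‖ := by rw [sub_add_cancel]
    _ ≤ _ := (norm_add_le _ _).trans (add_le_add h1 h2)

lemma frob_grads_sub_le (H : D.Admissible xs) (x x' : Fin n → Vec m) :
    frob (D.grads x' - D.grads x) ≤ D.L * frob (x' - x) :=
  frob_le_mul_frob_of_norm_le H.L_pos.le fun i => H.smooth i _ _

end Admissible

/-- One iteration of the algorithm: states `x`, increments `z`, quantization errors `e` of the
states, `ε` of the previous and `ε'` of the current values of `y`. -/
structure Step (D : Params n m) (x z e ε ε' x' z' : Fin n → Vec m) (a b : ℝ) : Prop where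
  x_next : x' = act D.Aα x + act (D.Aα - 1) e - D.η • z
  z_next : z' = act D.Bβ z + D.β • act D.B (ε' - ε) + (D.grads x' - D.grads x)
  z_sum : ∑ i, z i = ∑ i, D.grads x i + D.β • ∑ i, ε i
  a_nonneg : 0 ≤ a
  b_nonneg : 0 ≤ b
  e_le : ∀ i, supNorm (e i) ≤ a
  ε_le : ∀ i, supNorm (ε i) ≤ b
  ε'_le : ∀ i, supNorm (ε' i) ≤ a

/-! ### Error inequalities for one iteration -/

namespace Step

variable {x z e ε ε' x' z' : Fin n → Vec m} {a b : ℝ}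

lemma norm_sum_ε_le (S : D.Step x z e ε ε' x' z' a b) : ‖∑ i, ε i‖ ≤ n * Real.sqrt m * b := by
  refine (norm_sum_le _ _).trans ?_
  calc ∑ i, ‖ε i‖ ≤ ∑ _i : Fin n, Real.sqrt m * b := Finset.sum_le_sum fun i _ =>
        (norm_le_sqrt_mul_supNorm _).trans (by gcongr; exact S.ε_le i)
    _ = _ := by simp; ring

lemma norm_sum_z_le (H : D.Admissible xs)
    (S : D.Step x z e ε ε' x' z' a b) :
    ‖∑ i, z i‖ ≤ Real.sqrt n * D.L * colN D.NA (act D.RA x) + n * D.L * ‖D.avg x - xs‖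
      + D.β * (n * Real.sqrt m * b) := by
  rw [S.z_sum]
  refine (norm_add_le _ _).trans (add_le_add (H.norm_sum_grads_le x) ?_)
  rw [norm_smul, Real.norm_of_nonneg H.β_mem.1.le]
  exact mul_le_mul_of_nonneg_left (S.norm_sum_ε_le) H.β_mem.1.le

/-- Since πAᵀ(`Aα` - I) = 0, the encoding errors of the states leave the average untouched. -/
lemma avg_next (H : D.Admissible xs)
    (S : D.Step x z e ε ε' x' z' a b) : D.avg x' = D.avg x - D.η • D.avg z := by
  have key : ∀ M : Matrix (Fin n) (Fin n) ℝ, ∀ X : Fin n → Vec m,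
      D.avg (act M X) = ∑ j, (D.πA ᵥ* M) j • X j := fun M X => by
    simp only [avg, act_apply, Matrix.vecMul, dotProduct, Finset.sum_smul, Finset.smul_sum,
      mul_smul]
    exact Finset.sum_comm
  have hlin : D.avg x' = D.avg (act D.Aα x) + D.avg (act (D.Aα - 1) e) - D.η • D.avg z := by
    rw [S.x_next]
    simp [avg, smul_add, smul_sub, Finset.sum_add_distrib, Finset.sum_sub_distrib,
      Finset.smul_sum, smul_comm D.η]
  rw [hlin, key, key, Matrix.vecMul_sub, Matrix.vecMul_one, H.πA_vecMul_Aα]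
  simp [avg]

lemma optimality_le (H : D.Admissible xs)
    (S : D.Step x z e ε ε' x' z' a b) :
    ‖D.avg x' - xs‖ ≤ (1 - D.ηt * D.μ) * ‖D.avg x - xs‖
      + Real.sqrt n * D.ηt * D.L * colN D.NA (act D.RA x) + D.η * D.κ6 * colN D.NB (act D.RB z)
      + D.ηt * D.β * (n * Real.sqrt m * b) := by
  -- Exact gradient step at the average, error from evaluating gradients at the local states,
  -- encoding error of y, and deviation of z from the direction `πB`.
  have e1 : D.avg x' - xs = (D.avg x - xs - D.ηt • ∑ i, gradient (D.f i) (D.avg x))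
      + D.ηt • (∑ i, gradient (D.f i) (D.avg x) - ∑ i, D.grads x i)
      - (D.ηt * D.β) • ∑ i, ε i - D.η • ∑ i, D.πA i • act D.RB z i := by
    rw [S.avg_next H, avg_eq_smul_sum_add z, S.z_sum, ηt]
    module
  have h1 := H.norm_avg_step_le (D.avg x)
  have h2 := mul_le_mul_of_nonneg_left (H.norm_sum_grads_sub_le x) H.ηt_nonneg
  have h3 := mul_le_mul_of_nonneg_left (S.norm_sum_ε_le)
    (mul_nonneg H.ηt_nonneg H.β_mem.1.le)
  have h4 : D.η * ‖∑ i, D.πA i • act D.RB z i‖ ≤ D.η * (D.κ6 * colN D.NB (act D.RB z)) := by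
    refine mul_le_mul_of_nonneg_left ?_ H.η_nonneg
    exact (norm_sum_smul_le_frob _ _).trans
      (mul_le_mul_of_nonneg_left (frob_le_colN H.l2_le_NB _) (l2_nonneg _))
  rw [e1]
  refine (norm_sub_le _ _).trans ?_
  refine (add_le_add ((norm_sub_le _ _).trans (add_le_add (norm_add_le _ _) le_rfl)) le_rfl).trans
    ?_
  rw [norm_smul, norm_smul, norm_smul, Real.norm_of_nonneg H.ηt_nonneg,
    Real.norm_of_nonneg H.η_nonneg, Real.norm_of_nonneg (mul_nonneg H.ηt_nonneg H.β_mem.1.le)]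
  linarith

lemma consensus_le (H : D.Admissible xs)
    (S : D.Step x z e ε ε' x' z' a b) :
    colN D.NA (act D.RA x') ≤ D.σA * colN D.NA (act D.RA x)
      + D.δA2 * D.κ4 * (Real.sqrt (m * n) * a)
      + D.η * (D.κ1 * D.κ2 * ‖∑ i, z i‖ + D.δAB * D.κ1 * colN D.NB (act D.RB z)) := by
  have hNA := apply_mulVec_le_opN H.l2_le_NA H.δA2_pos H.NA_le_l2
  have e1 : act D.RA x' = act (D.Aα - Matrix.vecMulVec 1 D.πA) (act D.RA x)
      + act (D.Aα - 1) e - D.η • (act D.RA (fun i => D.πB i • ∑ j, z j)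
        + act D.RA (act D.RB z)) := by
    have hz : act D.RA z = act D.RA (fun i => D.πB i • ∑ j, z j) + act D.RA (act D.RB z) := by
      rw [← map_add, ← eq_smul_sum_add_act_RB z]
    calc act D.RA x' = act (D.RA * D.Aα) x + act (D.RA * (D.Aα - 1)) e - D.η • act D.RA z := by
          rw [S.x_next, map_sub, map_add, map_smul, act_mul, act_mul]
      _ = _ := by rw [H.RA_mul_Aα, H.RA_mul_Aα_sub_one, act_mul, hz]
  have h1 : colN D.NA (act (D.Aα - Matrix.vecMulVec 1 D.πA) (act D.RA x))
      ≤ D.σA * colN D.NA (act D.RA x) := colN_act_le (opN_nonneg _) (hNA _) _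
  have h2 : colN D.NA (act (D.Aα - 1) e) ≤ D.δA2 * (D.κ4 * (Real.sqrt (m * n) * a)) := by
    refine (colN_le_mul_frob H.δA2_pos.le H.NA_le_l2 _).trans ?_
    refine mul_le_mul_of_nonneg_left ((frob_act_le _ _).trans ?_) H.δA2_pos.le
    exact mul_le_mul_of_nonneg_left (frob_le_of_supNorm_le S.a_nonneg S.e_le) (l2op_nonneg _)
  have h3 : colN D.NA (act D.RA (fun i => D.πB i • ∑ j, z j)) ≤ D.κ1 * (D.κ2 * ‖∑ i, z i‖) := by
    rw [κ2, ← colN_smul_const]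
    exact colN_act_le (opN_nonneg _) (hNA _) _
  have h4 : colN D.NA (act D.RA (act D.RB z)) ≤ D.κ1 * (D.δAB * colN D.NB (act D.RB z)) := by
    refine (colN_act_le (opN_nonneg _) (hNA _) _).trans ?_
    exact mul_le_mul_of_nonneg_left (colN_le_mul H.δAB_pos.le fun c => H.NA_le_NB _)
      (opN_nonneg _)
  have h5 := mul_le_mul_of_nonneg_left ((colN_add_le D.NA _ _).trans (add_le_add h3 h4))
    H.η_nonneg
  rw [e1]
  refine (colN_sub_le _ _ _).trans ?_
  refine (add_le_add (colN_add_le _ _ _) le_rfl).trans ?_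
  rw [colN_smul, abs_of_nonneg H.η_nonneg]
  linarith

lemma frob_x_sub_le (H : D.Admissible xs)
    (S : D.Step x z e ε ε' x' z' a b) :
    frob (x' - x) ≤ D.κ4 * colN D.NA (act D.RA x) + D.κ4 * (Real.sqrt (m * n) * a)
      + D.η * (D.κ5 * ‖∑ i, z i‖ + colN D.NB (act D.RB z)) := by
  have e1 : x' - x = act (D.Aα - 1) (act D.RA x) + act (D.Aα - 1) e
      - D.η • ((fun i => D.πB i • ∑ j, z j) + act D.RB z) := by
    rw [← eq_smul_sum_add_act_RB z, ← act_mul, H.Aα_sub_one_mul_RA, S.x_next]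
    simp only [act_sub_left, act_one]
    abel
  have h1 : frob (act (D.Aα - 1) (act D.RA x)) ≤ D.κ4 * colN D.NA (act D.RA x) :=
    (frob_act_le _ _).trans
      (mul_le_mul_of_nonneg_left (frob_le_colN H.l2_le_NA _) (l2op_nonneg _))
  have h2 : frob (act (D.Aα - 1) e) ≤ D.κ4 * (Real.sqrt (m * n) * a) :=
    (frob_act_le _ _).trans
      (mul_le_mul_of_nonneg_left (frob_le_of_supNorm_le S.a_nonneg S.e_le) (l2op_nonneg _))
  have h3 : frob ((fun i => D.πB i • ∑ j, z j) + act D.RB z)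
      ≤ D.κ5 * ‖∑ i, z i‖ + colN D.NB (act D.RB z) :=
    (colN_add_le _ _ _).trans (add_le_add (le_of_eq (colN_smul_const _ _ _))
      (frob_le_colN H.l2_le_NB _))
  have h4 := mul_le_mul_of_nonneg_left h3 H.η_nonneg
  rw [e1]
  refine (colN_sub_le _ _ _).trans ?_
  refine (add_le_add (colN_add_le _ _ _) le_rfl).trans ?_
  rw [colN_smul, abs_of_nonneg H.η_nonneg]
  exact add_le_add (add_le_add h1 h2) h4

/-- The movement of x is left as a term here, entering through the Lipschitz gradients;
`frob_x_sub_le` bounds it separately. -/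
lemma tracking_le (H : D.Admissible xs)
    (S : D.Step x z e ε ε' x' z' a b) :
    colN D.NB (act D.RB z') ≤ D.σB * colN D.NB (act D.RB z)
      + D.κ3 * D.δB2 * (D.β * (n * Real.sqrt m * (a + b)) + D.L * frob (x' - x)) := by
  have hNB := apply_mulVec_le_opN H.l2_le_NB H.δB2_pos H.NB_le_l2
  have e1 : act D.RB z' = act (D.Bβ - Matrix.vecMulVec D.πB 1) (act D.RB z)
      + act D.RB (D.β • act D.B (ε' - ε) + (D.grads x' - D.grads x)) := by
    rw [← act_mul, ← H.RB_mul_Bβ, act_mul, ← map_add, S.z_next, add_assoc]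
  have h1 : colN D.NB (act (D.Bβ - Matrix.vecMulVec D.πB 1) (act D.RB z))
      ≤ D.σB * colN D.NB (act D.RB z) := colN_act_le (opN_nonneg _) (hNB _) _
  have hε : ∀ i, supNorm ((ε' - ε) i) ≤ a + b := fun i =>
    (supNorm_sub_le _ _).trans (add_le_add (S.ε'_le i) (S.ε_le i))
  have h2 : frob (D.β • act D.B (ε' - ε) + (D.grads x' - D.grads x))
      ≤ D.β * (n * Real.sqrt m * (a + b)) + D.L * frob (x' - x) := by
    refine (colN_add_le _ _ _).trans (add_le_add ?_ (H.frob_grads_sub_le x x'))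
    rw [colN_smul, abs_of_nonneg H.β_mem.1.le]
    exact mul_le_mul_of_nonneg_left
      (frob_act_le_of_column_stochastic H.B_nonneg H.B_col hε) H.β_mem.1.le
  have h3 : colN D.NB (act D.RB (D.β • act D.B (ε' - ε) + (D.grads x' - D.grads x)))
      ≤ D.κ3 * (D.δB2 * (D.β * (n * Real.sqrt m * (a + b)) + D.L * frob (x' - x))) := by
    refine (colN_act_le (opN_nonneg _) (hNB _) _).trans ?_
    refine mul_le_mul_of_nonneg_left ?_ (opN_nonneg _)
    refine (colN_le_mul_frob H.δB2_pos.le H.NB_le_l2 _).trans ?_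
    exact mul_le_mul_of_nonneg_left h2 H.δB2_pos.le
  rw [e1]
  refine (colN_add_le _ _ _).trans ?_
  linarith

end Step

/-- The linear system of inequalities for the errors. -/
lemma Step.Θ_le {x z e ε ε' x' z' : Fin n → Vec m} {k : ℕ}
    (H : D.Admissible xs) (hC : 0 < D.C) (hξ : 0 < D.ξ) (hξ1 : D.ξ < 1)
    (S : D.Step x z e ε ε' x' z' (D.C / 2 * D.ξ ^ ((k : ℤ) - 1)) (D.C / 2 * D.ξ ^ ((k : ℤ) - 2)))
    (i : Fin 3) :
    D.Θ xs x' z' i ≤ (D.G *ᵥ D.Θ xs x z) i + ![D.ς1 k, D.ς2 k, D.ς3 k] i := by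
  have h1 := S.optimality_le H
  have h2 := S.consensus_le H
  have h3 := S.tracking_le H
  have h4 := S.frob_x_sub_le H
  have h5 := S.norm_sum_z_le H
  rw [Θ_eq, Θ_eq]
  set X := ‖D.avg x - xs‖
  set Y := colN D.NA (act D.RA x)
  set Z := colN D.NB (act D.RB z)
  set s := ‖∑ i, z i‖
  set t := frob (x' - x)
  have hpow : D.ξ ^ ((k : ℤ) - 1) = D.ξ ^ ((k : ℤ) - 2) * D.ξ := by
    rw [← zpow_add_one₀ hξ.ne']; congr 1; ring
  have hp : 0 < D.ξ ^ ((k : ℤ) - 2) := zpow_pos hξ _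
  have hη := H.η_nonneg
  have hκ1 : 0 ≤ D.κ1 := opN_nonneg _
  have hκ2 : 0 ≤ D.κ2 := apply_nonneg _ _
  have hκ3 : 0 ≤ D.κ3 := opN_nonneg _
  have hκ4 : 0 ≤ D.κ4 := l2op_nonneg _
  have hκ5 : 0 ≤ D.κ5 := l2_nonneg _
  have hL := H.L_pos
  have hB2 := H.δB2_pos
  rw [hpow] at h2 h3 h4
  rw [Real.sqrt_mul (by positivity)] at h2 h4
  fin_cases i
  · simp [G, Matrix.mulVec, dotProduct, Fin.sum_univ_three, ς1]
    linarith
  · simp [G, Matrix.mulVec, dotProduct, Fin.sum_univ_three, ς2, hpow]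
    have := mul_le_mul_of_nonneg_left h5 (by positivity : 0 ≤ D.η * (D.κ1 * D.κ2))
    linarith
  · simp [G, Matrix.mulVec, dotProduct, Fin.sum_univ_three, ς3]
    have e1 := mul_le_mul_of_nonneg_left h5
      (by positivity : 0 ≤ D.κ3 * D.δB2 * D.L * (D.η * D.κ5))
    have e2 := mul_le_mul_of_nonneg_left h4 (by positivity : 0 ≤ D.κ3 * D.δB2 * D.L)
    -- `ς3` has `δA2` ξ^(k-2) where the estimate produces ξ^(k-1); the gap is ξ < 1 ≤ `δA2`.
    have e3 : D.κ3 * D.δB2 * D.L * (D.κ4 * (Real.sqrt m * Real.sqrt n *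
        (D.C / 2 * D.ξ ^ ((k : ℤ) - 2)))) * D.ξ
        ≤ D.κ3 * D.δB2 * D.L * (D.κ4 * (Real.sqrt m * Real.sqrt n *
        (D.C / 2 * D.ξ ^ ((k : ℤ) - 2)))) * D.δA2 := by
      gcongr
      exact hξ1.le.trans H.one_le_δA2
    linarith

end Params

/-! ### Powers of the system matrix -/

/-- Exponents start at 1, because submultiplicativity does not give N 1 ≤ 1. -/
lemma Seminorm.apply_pow_le {R : Type*} [Ring R] [Module ℂ R] {N : Seminorm ℂ R} {r : ℝ}
    (hN : ∀ M M', N (M * M') ≤ N M * N M') {M : R} (hM : N M ≤ r) (k : ℕ) :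
    N (M ^ (k + 1)) ≤ r ^ (k + 1) := by
  induction k with
  | zero => simpa using hM
  | succ k ih =>
    rw [pow_succ, pow_succ r]
    exact (hN _ _).trans (mul_le_mul ih hM (apply_nonneg N M)
      (pow_nonneg ((apply_nonneg N M).trans hM) _))

/-- Powers of `G` decay geometrically. -/
lemma IsGeomConst.l2op_pow_le {G : Matrix (Fin 3) (Fin 3) ℝ} {r c : ℝ} (h : IsGeomConst G r c)
    {k : ℕ} (hk : 1 ≤ k) : l2op (G ^ k) ≤ c * r ^ k := by
  obtain ⟨P, Λ, N, τ, hP, -, hG, hN0, hN, hr, hτ, hτG, rfl⟩ := h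
  obtain ⟨k, rfl⟩ := Nat.exists_eq_add_of_le' hk
  have hmap : (G ^ (k + 1)).map Complex.ofReal = (G.map Complex.ofReal) ^ (k + 1) :=
    map_pow (Complex.ofRealHom.mapMatrix) G (k + 1)
  have hPP : P * P⁻¹ = 1 := Matrix.mul_nonsing_inv P hP
  have hP'P : P⁻¹ * P = 1 := Matrix.nonsing_inv_mul P hP
  refine (hτG (k + 1)).trans ?_
  rw [hmap, mul_assoc τ, mul_assoc τ]
  refine mul_le_mul_of_nonneg_left ?_ hτ
  rcases hr with hr | hr
  · have hconj : (G.map Complex.ofReal) ^ (k + 1) = P⁻¹ * Λ ^ (k + 1) * P := by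
      induction k with
      | zero => simpa using hG
      | succ k ih =>
        rw [pow_succ, ih (by omega) (map_pow (Complex.ofRealHom.mapMatrix) G (k + 1)), hG,
          pow_succ Λ (k + 1)]
        calc P⁻¹ * Λ ^ (k + 1) * P * (P⁻¹ * Λ * P)
            = P⁻¹ * Λ ^ (k + 1) * (P * P⁻¹) * (Λ * P) := by simp only [mul_assoc]
          _ = _ := by rw [hPP, mul_one]; simp only [mul_assoc]
    rw [hconj]
    calc N (P⁻¹ * Λ ^ (k + 1) * P) ≤ N P⁻¹ * N (Λ ^ (k + 1)) * N P :=
          (hN _ _).trans (mul_le_mul_of_nonneg_right (hN _ _) (apply_nonneg _ _))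
      _ ≤ N P⁻¹ * r ^ (k + 1) * N P := by
          gcongr
          exact Seminorm.apply_pow_le hN hr k
      _ = _ := by ring
  -- If `G` itself has norm at most r, conjugation is not needed, and the factor N P⁻¹ · N P ≥ N 1 ≥
  -- 1 only weakens the bound.
  · have h1 : 1 ≤ N P⁻¹ * N P := by
      have hpos : 0 < N 1 := (apply_nonneg N 1).lt_of_ne fun h => one_ne_zero (hN0 1 h.symm)
      have h11 := hN 1 1
      have hPN := hN P⁻¹ P
      rw [mul_one] at h11
      rw [hP'P] at hPN
      have : 1 ≤ N 1 := by
        by_contra! hlt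
        nlinarith
      exact this.trans hPN
    have h2 := Seminorm.apply_pow_le hN hr k
    have h3 : 0 ≤ r ^ (k + 1) := (apply_nonneg _ _).trans h2
    nlinarith

lemma mulVec_le_mulVec {ι : Type*} [Fintype ι] {M : Matrix ι ι ℝ} (hM : ∀ i j, 0 ≤ M i j)
    {v w : ι → ℝ} (h : v ≤ w) : M *ᵥ v ≤ M *ᵥ w := fun i =>
  Finset.sum_le_sum fun j _ => mul_le_mul_of_nonneg_left (h j) (hM i j)

/-- Iteration of a linear system of inequalities with nonnegative coefficients. -/
lemma le_pow_mulVec_add_sum {ι : Type*} [Fintype ι] [DecidableEq ι] {M : Matrix ι ι ℝ}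
    (hM : ∀ i j, 0 ≤ M i j) {v w : ℕ → ι → ℝ} {K : ℕ}
    (h : ∀ k, 1 ≤ k → k ≤ K → v (k + 1) ≤ M *ᵥ v k + w k) {j : ℕ} (hj : j ≤ K) :
    v (j + 1) ≤ (M ^ j) *ᵥ v 1 + ∑ l ∈ Finset.Icc 1 j, (M ^ (j - l)) *ᵥ w l := by
  induction j with
  | zero => simp
  | succ j ih =>
    refine (h (j + 1) (by omega) hj).trans ?_
    have h1 := mulVec_le_mulVec hM (ih (by omega))
    rw [Finset.sum_Icc_succ_top (by omega), Nat.sub_self, pow_zero, Matrix.one_mulVec, ← add_assoc]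
    refine add_le_add (h1.trans (le_of_eq ?_)) le_rfl
    rw [Matrix.mulVec_add, Matrix.mulVec_mulVec, ← pow_succ', Matrix.mulVec_sum]
    congr 1
    refine Finset.sum_congr rfl fun l hl => ?_
    rw [Finset.mem_Icc] at hl
    rw [Matrix.mulVec_mulVec, ← pow_succ', Nat.sub_add_comm hl.2]

lemma l2_sum_le {ι κ : Type*} [Fintype ι] (s : Finset κ) (v : κ → ι → ℝ) :
    l2 (∑ l ∈ s, v l) ≤ ∑ l ∈ s, l2 (v l) := by
  simpa [l2] using norm_sum_le s fun l => (WithLp.toLp 2 (v l) : EuclideanSpace ℝ ι)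

lemma add_add_le_sqrt_three_mul_l2 (v : Fin 3 → ℝ) : v 0 + v 1 + v 2 ≤ Real.sqrt 3 * l2 v := by
  have h := sum_abs_le_l2 v
  rw [Fin.sum_univ_three, Fintype.card_fin] at h
  push_cast at h
  linarith [le_abs_self (v 0), le_abs_self (v 1), le_abs_self (v 2)]

/-! ### From the linear system to non-saturation -/

namespace Params

variable {n m : ℕ} {D : Params n m} {xs : Vec m}

lemma Θ_nonneg (x z : Fin n → Vec m) (i : Fin 3) : 0 ≤ D.Θ xs x z i := by
  fin_cases i
  · exact norm_nonneg _
  · exact colN_nonneg _ _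
  · exact colN_nonneg _ _

lemma Admissible.G_nonneg (H : D.Admissible xs) (i j : Fin 3) : 0 ≤ D.G i j := by
  have hη := H.η_nonneg
  have hηt := H.ηt_nonneg
  have hκ1 : 0 ≤ D.κ1 := opN_nonneg _
  have hκ2 : 0 ≤ D.κ2 := apply_nonneg _ _
  have hκ3 : 0 ≤ D.κ3 := opN_nonneg _
  have hκ4 : 0 ≤ D.κ4 := l2op_nonneg _
  have hκ5 : 0 ≤ D.κ5 := l2_nonneg _
  have hκ6 : 0 ≤ D.κ6 := l2_nonneg _
  have hσA : 0 ≤ D.σA := opN_nonneg _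
  have hσB : 0 ≤ D.σB := opN_nonneg _
  have hL := H.L_pos
  have hAB := H.δAB_pos
  have hB2 := H.δB2_pos
  have h00 : 0 ≤ 1 - D.ηt * D.μ := by
    have h := H.stepRange.2.1
    have := mul_nonneg hηt hL.le
    rw [ηt] at this ⊢
    linarith
  fin_cases i <;> fin_cases j <;> simp only [G] <;> first | exact h00 | (simp; positivity)

/-- The geometric bound for the errors, as long as the linear system of inequalities holds. -/
lemma Admissible.l2_Θ_le (H : D.Admissible xs) (hξ : 0 < D.ξ) {rhat Pc : ℝ}
    (hPc : IsGeomConst D.G rhat Pc) {x z : ℕ → Fin n → Vec m} {K : ℕ}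
    (h : ∀ k, 1 ≤ k → k ≤ K → ∀ i, D.Θ xs (x (k + 1)) (z (k + 1)) i
      ≤ (D.G *ᵥ D.Θ xs (x k) (z k)) i + ![D.ς1 k, D.ς2 k, D.ς3 k] i)
    {j : ℕ} (hj1 : 1 ≤ j) (hj : j ≤ K) :
    l2 (D.Θ xs (x (j + 1)) (z (j + 1)))
      ≤ D.ξ ^ j * D.upsBound rhat Pc (l2 (D.Θ xs (x 1) (z 1))) j := by
  have h1 := le_pow_mulVec_add_sum H.G_nonneg (v := fun k => D.Θ xs (x k) (z k))
    (w := fun k => ![D.ς1 k, D.ς2 k, D.ς3 k]) h hj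
  refine (l2_le_of_le (Θ_nonneg _ _) h1).trans ?_
  obtain ⟨j, rfl⟩ := Nat.exists_eq_add_of_le' hj1
  -- The last summand is split off: its matrix is G⁰ = 1, so it carries no factor `Pc`.
  rw [upsBound, mul_div_cancel₀ _ (pow_pos hξ _).ne', Finset.sum_Icc_succ_top (by omega),
    Nat.sub_self, pow_zero, Matrix.one_mulVec, ← add_assoc, Nat.add_sub_cancel]
  refine (l2_add_le _ _).trans (add_le_add ((l2_add_le _ _).trans (add_le_add ?_ ?_)) le_rfl)
  · refine (l2_mulVec_le _ _).trans ?_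
    have := mul_le_mul_of_nonneg_right (hPc.l2op_pow_le hj1) (l2_nonneg (D.Θ xs (x 1) (z 1)))
    linarith
  · refine (l2_sum_le _ _).trans ?_
    rw [Finset.mul_sum]
    refine Finset.sum_le_sum fun l hl => ?_
    rw [Finset.mem_Icc] at hl
    refine (l2_mulVec_le _ _).trans ?_
    rw [← mul_assoc]
    exact mul_le_mul_of_nonneg_right (hPc.l2op_pow_le (by omega)) (l2_nonneg _)

/-! ### Bounds for the quantizer inputs -/

/-- The total error is kept as a vector sum rather than estimated termwise, because at time 0 it
vanishes exactly. -/
lemma Admissible.supNorm_z_le (H : D.Admissible xs) {x z ε : Fin n → Vec m}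
    (hz : ∑ i, z i = ∑ i, D.grads x i + D.β • ∑ i, ε i) (i : Fin n) :
    supNorm (z i) ≤ Real.sqrt n * D.L * D.Θ xs x z 1 + n * D.L * D.Θ xs x z 0 + D.Θ xs x z 2
      + D.β * supNorm (∑ i, ε i) := by
  have hπ : D.πB i ≤ 1 := by
    rw [← H.πB_sum]
    exact Finset.single_le_sum (fun j _ => H.πB_nonneg j) (Finset.mem_univ i)
  have e1 : z i = D.πB i • ∑ j, z j + act D.RB z i := by rw [act_RB_apply]; abel
  have h1 : supNorm (∑ i, z i) ≤ Real.sqrt n * D.L * colN D.NA (act D.RA x)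
      + n * D.L * ‖D.avg x - xs‖ + D.β * supNorm (∑ i, ε i) := by
    rw [hz]
    refine (supNorm_add_le _ _).trans (add_le_add
      ((supNorm_le_norm _).trans (H.norm_sum_grads_le x)) (le_of_eq ?_))
    rw [supNorm_smul, abs_of_nonneg H.β_mem.1.le]
  have h2 : supNorm (act D.RB z i) ≤ colN D.NB (act D.RB z) :=
    (supNorm_le_norm _).trans ((norm_le_frob _ _).trans (frob_le_colN H.l2_le_NB _))
  have h3 : supNorm (D.πB i • ∑ j, z j) ≤ supNorm (∑ j, z j) := by
    rw [supNorm_smul, abs_of_nonneg (H.πB_nonneg i)]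
    exact mul_le_of_le_one_left (supNorm_nonneg _) hπ
  rw [Θ_eq]
  have h4 := supNorm_add_le (D.πB i • ∑ j, z j) (act D.RB z i)
  rw [← e1] at h4
  simp only [Matrix.cons_val]
  linarith

lemma Admissible.supNorm_x_next_sub_le (H : D.Admissible xs) {x z e ε x' : Fin n → Vec m}
    (hz : ∑ i, z i = ∑ i, D.grads x i + D.β • ∑ i, ε i)
    (hx : x' = act D.Aα x + act (D.Aα - 1) e - D.η • z) {a : ℝ} (he : ∀ i, supNorm (e i) ≤ a)
    (i : Fin n) :
    supNorm (x' i - (x i + e i)) ≤ Real.sqrt 3 * D.κ7 * l2 (D.Θ xs x z) + (1 + 2 * D.α) * a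
      + D.η * D.β * supNorm (∑ i, ε i) := by
  have hα := H.α_mem.1.le
  have hη := H.η_nonneg
  have hL := H.L_pos
  have hn1 : (1 : ℝ) ≤ n := by exact_mod_cast H.n_pos
  have hav : ∀ (u : Fin n → Vec m) (b : ℝ), (∀ j, supNorm (u j) ≤ b) →
      supNorm (∑ j, D.A i j • u j) ≤ b := fun u b hu => by
    calc supNorm (∑ j, D.A i j • u j) ≤ ∑ j, D.A i j * b := by
          refine (supNorm_sum_le _ _).trans (Finset.sum_le_sum fun j _ => ?_)
          rw [supNorm_smul, abs_of_nonneg (H.A_nonneg i j)]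
          exact mul_le_mul_of_nonneg_left (hu j) (H.A_nonneg i j)
      _ = b := by rw [← Finset.sum_mul, H.A_row, one_mul]
  have h1 : supNorm (∑ j, D.A i j • (x j - x i)) ≤ Real.sqrt 2 * D.Θ xs x z 1 := by
    refine hav _ _ fun j => (supNorm_le_norm _).trans ?_
    have := norm_sub_le_frob (act D.RA x) j i
    rw [act_RA_apply, act_RA_apply, sub_sub_sub_cancel_right] at this
    rw [Θ_eq]
    exact this.trans (mul_le_mul_of_nonneg_left (frob_le_colN H.l2_le_NA _) (Real.sqrt_nonneg _))
  have h2 := hav e a he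
  have h3 := H.supNorm_z_le hz i
  have hsum : ∑ j, D.A i j • (x j - x i) = ∑ j, D.A i j • x j - x i := by
    simp_rw [smul_sub]
    rw [Finset.sum_sub_distrib, ← Finset.sum_smul, H.A_row, one_smul]
  -- The vector x i + e i is the encoder state p i. The last two error terms sum to at most α a + (1
  -- + α) a, whence the factor 1 + 2α.
  have e1 : x' i - (x i + e i) = D.α • ∑ j, D.A i j • (x j - x i)
      + D.α • ∑ j, D.A i j • e j - (1 + D.α) • e i - D.η • z i := by
    rw [hsum, hx]
    simp only [Aα, act_sub_left, act_add_left, act_smul_left, act_one, Pi.add_apply, Pi.sub_apply,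
      Pi.smul_apply, act_apply]
    module
  have h4 : supNorm (x' i - (x i + e i)) ≤ D.α * (Real.sqrt 2 * D.Θ xs x z 1) + D.α * a
      + (1 + D.α) * a + D.η * supNorm (z i) := by
    rw [e1]
    refine (supNorm_sub_le _ _).trans (add_le_add ((supNorm_sub_le _ _).trans (add_le_add
      ((supNorm_add_le _ _).trans (add_le_add ?_ ?_)) ?_)) ?_)
    · rw [supNorm_smul, abs_of_nonneg hα]; gcongr
    · rw [supNorm_smul, abs_of_nonneg hα]; gcongr
    · rw [supNorm_smul, abs_of_nonneg (by linarith)]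
      exact mul_le_mul_of_nonneg_left (he i) (by linarith)
    · rw [supNorm_smul, abs_of_nonneg hη]
  have h5 := mul_le_mul_of_nonneg_left h3 hη
  have hX := Θ_nonneg (D := D) (xs := xs) x z 0
  have hY := Θ_nonneg (D := D) (xs := xs) x z 1
  have hZ := Θ_nonneg (D := D) (xs := xs) x z 2
  -- The estimate needs only √2 α; the factor n + 1/2 ≥ 1 in `κ7` is slack.
  have k1 : Real.sqrt 2 * D.α + D.η * Real.sqrt n * D.L ≤ D.κ7 := by
    refine le_trans ?_ (le_max_left _ _)
    have : Real.sqrt 2 * 1 * D.α ≤ Real.sqrt 2 * (n + 1 / 2) * D.α := by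
      gcongr; linarith
    linarith
  have k2 : D.η ≤ D.κ7 := (le_max_left _ _).trans (le_max_right _ _)
  have k3 : D.η * n * D.L ≤ D.κ7 := (le_max_right _ _).trans (le_max_right _ _)
  have k0 : 0 ≤ D.κ7 := hη.trans k2
  have h6 := mul_le_mul_of_nonneg_left (add_add_le_sqrt_three_mul_l2 (D.Θ xs x z)) k0
  have m1 := mul_le_mul_of_nonneg_right k1 hY
  have m2 := mul_le_mul_of_nonneg_right k2 hZ
  have m3 := mul_le_mul_of_nonneg_right k3 hX
  linarith

lemma Admissible.supNorm_z_le_l2_Θ (H : D.Admissible xs) {x z ε : Fin n → Vec m}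
    (hz : ∑ i, z i = ∑ i, D.grads x i + D.β • ∑ i, ε i) (i : Fin n) :
    supNorm (z i) ≤ Real.sqrt 3 * D.κ8 * l2 (D.Θ xs x z) + D.β * supNorm (∑ i, ε i) := by
  have h := H.supNorm_z_le hz i
  have k1 : 1 ≤ D.κ8 := le_max_left _ _
  have k2 : Real.sqrt n * D.L ≤ D.κ8 := (le_max_left _ _).trans (le_max_right _ _)
  have k3 : n * D.L ≤ D.κ8 := (le_max_right _ _).trans (le_max_right _ _)
  have h6 := mul_le_mul_of_nonneg_left (add_add_le_sqrt_three_mul_l2 (D.Θ xs x z))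
    (zero_le_one.trans k1)
  have m1 := mul_le_mul_of_nonneg_right k1 (Θ_nonneg (D := D) (xs := xs) x z 2)
  have m2 := mul_le_mul_of_nonneg_right k2 (Θ_nonneg (D := D) (xs := xs) x z 1)
  have m3 := mul_le_mul_of_nonneg_right k3 (Θ_nonneg (D := D) (xs := xs) x z 0)
  linarith

/-! ### Runs of the algorithm -/

lemma h_pos (hC : 0 < D.C) (hξ : 0 < D.ξ) (k : ℕ) : 0 < D.h k := mul_pos hC (pow_pos hξ k)

/-- The error of an encoder whose quantizer does not saturate. -/
lemma supNorm_encoder_error_le (hC : 0 < D.C) (hξ : 0 < D.ξ) {K k : ℕ}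
    {w q : ℕ → Fin n → Vec m} {i : Fin n}
    (hq : q (k + 1) i = D.h k • Quant K (D.qInput w q (k + 1) i) + q k i)
    (hsat : ¬ Saturates K (D.qInput w q (k + 1) i)) :
    supNorm (q (k + 1) i - w (k + 1) i) ≤ D.h k / 2 := by
  have hpos := h_pos hC hξ k
  have e : q (k + 1) i - w (k + 1) i
      = D.h k • (Quant K (D.qInput w q (k + 1) i) - D.qInput w q (k + 1) i) := by
    have : D.h k • D.qInput w q (k + 1) i = w (k + 1) i - q k i := by
      rw [qInput, Nat.add_sub_cancel, smul_smul, mul_one_div_cancel hpos.ne', one_smul]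
    rw [smul_sub, this, hq]
    abel
  rw [e, supNorm_smul, abs_of_pos hpos]
  have := mul_le_mul_of_nonneg_left (supNorm_Quant_sub_le hsat) hpos.le
  linarith

lemma not_saturates_of_le (hC : 0 < D.C) (hξ : 0 < D.ξ) {K k : ℕ} {w q : ℕ → Fin n → Vec m}
    {i : Fin n} (h : supNorm (w (k + 1) i - q k i) ≤ D.h k * (K + 1 / 2)) :
    ¬ Saturates K (D.qInput w q (k + 1) i) := by
  have hpos := h_pos hC hξ k
  rw [Saturates, not_lt, qInput, Nat.add_sub_cancel, supNorm_smul,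
    abs_of_pos (one_div_pos.2 hpos), one_div, inv_mul_le_iff₀ hpos]
  exact h

namespace IsRun

variable {Kx Ky : ℕ → ℕ} {ym : Fin n → Vec m} {x y p s : ℕ → Fin n → Vec m}

lemma x_next (H : D.Admissible xs) (R : D.IsRun Kx Ky ym x y p s) (t : ℕ) :
    x (t + 2) = act D.Aα (x (t + 1)) + act (D.Aα - 1) (p (t + 1) - x (t + 1))
      - D.η • (y (t + 1) - y t) := by
  ext1 i
  have hsum : ∑ j, D.A i j • (p (t + 1) j - p (t + 1) i)
      = ∑ j, D.A i j • p (t + 1) j - p (t + 1) i := by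
    simp_rw [smul_sub]
    rw [Finset.sum_sub_distrib, ← Finset.sum_smul, H.A_row, one_smul]
  rw [R.x_succ, hsum]
  simp only [Aα, act_sub_left, act_add_left, act_smul_left, act_one, Pi.add_apply, Pi.sub_apply,
    Pi.smul_apply, map_sub, act_apply]
  module

lemma y_next (R : D.IsRun Kx Ky ym x y p s) (t : ℕ) :
    y (t + 1) = (1 - D.β) • y t + D.β • act D.B (s t) + D.grads (x (t + 1)) := by
  ext1 i
  rw [R.y_succ]
  rfl

/-- Writing s = y + (s - y) merges the self-weight 1 - β with β `B` into `Bβ`. -/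
lemma z_next (R : D.IsRun Kx Ky ym x y p s) (t : ℕ) :
    y (t + 2) - y (t + 1) = act D.Bβ (y (t + 1) - y t)
      + D.β • act D.B ((s (t + 1) - y (t + 1)) - (s t - y t))
      + (D.grads (x (t + 2)) - D.grads (x (t + 1))) := by
  have h1 := R.y_next t
  have h2 := R.y_next (t + 1)
  have e : y (t + 2) - y (t + 1) = (1 - D.β) • y (t + 1) + D.β • act D.B (s (t + 1))
      + D.grads (x (t + 2)) - ((1 - D.β) • y t + D.β • act D.B (s t) + D.grads (x (t + 1))) := by
    rw [← h1, ← h2]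
  rw [e]
  simp only [Bβ, act_add_left, act_smul_left, act_one, map_sub]
  module

/-- Column sums 1 let β times the total of y(t) cancel against that of s(t), up to the current
encoding error. -/
lemma z_sum (H : D.Admissible xs) (R : D.IsRun Kx Ky ym x y p s) (t : ℕ) :
    ∑ i, (y (t + 1) - y t) i
      = ∑ i, D.grads (x (t + 1)) i + D.β • ∑ i, (s t - y t) i := by
  have hB : ∑ i, act D.B (s t) i = ∑ i, s t i := by
    simp only [act_apply]
    rw [Finset.sum_comm]
    simp_rw [← Finset.sum_smul, H.B_col, one_smul]
  rw [R.y_next t]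
  simp only [Pi.sub_apply, Pi.add_apply, Pi.smul_apply, Finset.sum_sub_distrib,
    Finset.sum_add_distrib, ← Finset.smul_sum, hB]
  module

lemma supNorm_p_sub_x_le (hC : 0 < D.C) (hξ : 0 < D.ξ) (R : D.IsRun Kx Ky ym x y p s) {t : ℕ}
    {i : Fin n} (hsat : ¬ Saturates (Kx (t + 1)) (D.qInput x p (t + 1) i)) :
    supNorm (p (t + 1) i - x (t + 1) i) ≤ D.C / 2 * D.ξ ^ t := by
  have := supNorm_encoder_error_le hC hξ (R.p_succ t i) hsat
  rw [h] at this
  linarith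

/-- At t = 0 nothing is encoded and the error is y(0) itself; its assumed size C/(2ξ) is the value
of the general bound with exponent -1, which is why integer powers are used. -/
lemma supNorm_s_sub_y_le (hC : 0 < D.C) (hξ : 0 < D.ξ) (R : D.IsRun Kx Ky ym x y p s)
    (hy0 : ∀ i, supNorm (y 0 i) ≤ D.C / (2 * D.ξ)) {t : ℕ} {i : Fin n}
    (hsat : 1 ≤ t → ¬ Saturates (Ky t) (D.qInput y s t i)) :
    supNorm (s t i - y t i) ≤ D.C / 2 * D.ξ ^ ((t : ℤ) - 1) := by
  cases t with
  | zero =>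
    rw [R.s_zero, zero_sub, supNorm_neg]
    refine (hy0 i).trans (le_of_eq ?_)
    simp
    ring
  | succ t =>
    have := supNorm_encoder_error_le hC hξ (R.s_succ t i) (hsat (by omega))
    rw [h] at this
    push_cast
    rw [add_sub_cancel_right, zpow_natCast]
    linarith

lemma step (H : D.Admissible xs) (hC : 0 < D.C) (hξ : 0 < D.ξ) (R : D.IsRun Kx Ky ym x y p s)
    (hy0 : ∀ i, supNorm (y 0 i) ≤ D.C / (2 * D.ξ)) {t : ℕ}
    (hsat : ∀ k, 1 ≤ k → k ≤ t + 1 → ∀ i,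
      ¬ Saturates (Kx k) (D.qInput x p k i) ∧ ¬ Saturates (Ky k) (D.qInput y s k i)) :
    D.Step (x (t + 1)) (y (t + 1) - y t) (p (t + 1) - x (t + 1)) (s t - y t)
      (s (t + 1) - y (t + 1)) (x (t + 2)) (y (t + 2) - y (t + 1))
      (D.C / 2 * D.ξ ^ (((t + 1 : ℕ) : ℤ) - 1)) (D.C / 2 * D.ξ ^ (((t + 1 : ℕ) : ℤ) - 2)) where
  x_next := R.x_next H t
  z_next := R.z_next t
  z_sum := R.z_sum H t
  a_nonneg := by positivity
  b_nonneg := by positivity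
  e_le i := by
    have := R.supNorm_p_sub_x_le hC hξ (hsat (t + 1) (by omega) le_rfl i).1
    push_cast
    rw [add_sub_cancel_right, zpow_natCast]
    exact this
  ε_le i := by
    have := R.supNorm_s_sub_y_le hC hξ hy0 (t := t) (i := i)
      fun h => (hsat t h (by omega) i).2
    have e : ((t + 1 : ℕ) : ℤ) - 2 = (t : ℤ) - 1 := by push_cast; ring
    rw [e]
    exact this
  ε'_le i := R.supNorm_s_sub_y_le hC hξ hy0 fun _ => (hsat (t + 1) (by omega) le_rfl i).2

end IsRun

/-- If the quantizers have not saturated before time `k`, they do not saturate at time `k`. -/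
lemma Admissible.not_saturates (H : D.Admissible xs) (hC : 0 < D.C) (hξ : 0 < D.ξ) (hξ1 : D.ξ < 1)
    {rhat Pc : ℝ} (hPc : IsGeomConst D.G rhat Pc)
    {Kx Ky : ℕ → ℕ} {ym : Fin n → Vec m} {x y p s : ℕ → Fin n → Vec m}
    (R : D.IsRun Kx Ky ym x y p s)
    (hy0 : ∑ i, y 0 i = 0) (hy0' : ∀ i, supNorm (y 0 i) ≤ D.C / (2 * D.ξ))
    {CΘ : ℝ} (hCΘ : CΘ = l2 (D.Θ xs (x 1) (fun i => y 1 i - y 0 i)))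
    (hKx2 : Real.sqrt 3 * D.κ7 / (D.C * D.ξ) * CΘ + (2 * D.α * n + 1) / (2 * D.ξ) - 1 / 2 ≤ Kx 2)
    (hKx : ∀ k, 3 ≤ k →
      Real.sqrt 3 * D.κ7 / (D.C * D.ξ) * D.upsBound rhat Pc CΘ (k - 2)
        + (2 * D.α * n + 1) / (2 * D.ξ) + n * D.η * D.β / (2 * D.ξ ^ 2) - 1 / 2 ≤ Kx k)
    (hKy : ∀ k, 2 ≤ k →
      Real.sqrt 3 * D.κ8 / D.C * D.upsBound rhat Pc CΘ (k - 1)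
        + (n * Real.sqrt m * D.β + 1) / (2 * D.ξ) - 1 / 2 ≤ Ky k)
    {t : ℕ} (hsat : ∀ k, 1 ≤ k → k ≤ t + 1 → ∀ i,
      ¬ Saturates (Kx k) (D.qInput x p k i) ∧ ¬ Saturates (Ky k) (D.qInput y s k i))
    (i : Fin n) :
    ¬ Saturates (Kx (t + 2)) (D.qInput x p (t + 2) i) ∧
      ¬ Saturates (Ky (t + 2)) (D.qInput y s (t + 2) i) := by
  have hn1 : (1 : ℝ) ≤ n := by exact_mod_cast H.n_pos
  have hm1 : 1 ≤ Real.sqrt m := Real.one_le_sqrt.2 (by exact_mod_cast H.m_pos)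
  have hα := H.α_mem.1.le
  have hβ := H.β_mem.1.le
  have hη := H.η_nonneg
  have hk7 : 0 ≤ D.κ7 := hη.trans ((le_max_left _ _).trans (le_max_right _ _))
  have hk8 : 0 ≤ D.κ8 := zero_le_one.trans (le_max_left _ _)
  let z : ℕ → Fin n → Vec m := fun k => y k - y (k - 1)
  have hCΘ' : CΘ = l2 (D.Θ xs (x 1) (z 1)) := hCΘ
  -- The range reaches j = t + 1, that is `Θ` at time t + 2: only encoding errors up to time t + 1
  -- are involved.
  have hΘ : ∀ j, 1 ≤ j → j ≤ t + 1 →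
      l2 (D.Θ xs (x (j + 1)) (z (j + 1))) ≤ D.ξ ^ j * D.upsBound rhat Pc CΘ j := by
    intro j hj1 hj
    rw [hCΘ']
    refine H.l2_Θ_le hξ hPc (K := t + 1) (fun k hk1 hk => ?_) hj1 hj
    obtain ⟨k, rfl⟩ := Nat.exists_eq_add_of_le' hk1
    exact Step.Θ_le H hC hξ hξ1
      (R.step H hC hξ hy0' fun r hr1 hr => hsat r hr1 (hr.trans hk))
  have hε : ∀ r, 1 ≤ r → r ≤ t + 1 →
      supNorm (∑ i, (s r - y r) i) ≤ n * (D.C / 2 * D.ξ ^ (r - 1)) := by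
    intro r hr1 hr
    refine (supNorm_sum_le _ _).trans ?_
    have : ∀ i, supNorm ((s r - y r) i) ≤ D.C / 2 * D.ξ ^ (r - 1) := fun i => by
      have := R.supNorm_s_sub_y_le hC hξ hy0' (fun _ => (hsat r hr1 hr i).2)
      have e : (r : ℤ) - 1 = ((r - 1 : ℕ) : ℤ) := by omega
      rw [e, zpow_natCast] at this
      exact this
    refine (Finset.sum_le_sum fun i _ => this i).trans (le_of_eq ?_)
    simp
  have he : ∀ i, supNorm ((p (t + 1) - x (t + 1)) i) ≤ D.C / 2 * D.ξ ^ t := fun i =>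
    R.supNorm_p_sub_x_le hC hξ (hsat (t + 1) (by omega) le_rfl i).1
  constructor
  · refine not_saturates_of_le hC hξ ?_
    have h1 := H.supNorm_x_next_sub_le (R.z_sum H t) (R.x_next H t) he i
    rw [Pi.sub_apply, add_sub_cancel] at h1
    refine h1.trans ?_
    have hα2 : (1 + 2 * D.α) * (D.C / 2 * D.ξ ^ t)
        ≤ (2 * D.α * n + 1) * (D.C / 2 * D.ξ ^ t) :=
      mul_le_mul_of_nonneg_right (by linarith [mul_nonneg hα (sub_nonneg.2 hn1)]) (by positivity)
    rw [h]
    cases t with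
    | zero =>
      -- Here s(0) = 0 and y(0) has sum zero, so the level at time 2 needs no term in η β.
      have h0 : ∑ i, (s 0 - y 0) i = 0 := by simp [R.s_zero, hy0]
      have h0' : supNorm (0 : Vec m) = 0 := by simp [supNorm]
      rw [h0, h0']
      have hK := mul_le_mul_of_nonneg_left hKx2 (mul_pos hC hξ).le
      have e : D.C * D.ξ * (Real.sqrt 3 * D.κ7 / (D.C * D.ξ) * CΘ
          + (2 * D.α * n + 1) / (2 * D.ξ) - 1 / 2)
          = Real.sqrt 3 * D.κ7 * CΘ + (2 * D.α * n + 1) * (D.C / 2) - D.C * D.ξ / 2 := by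
        field_simp
      rw [e, hCΘ'] at hK
      simp only [z] at hK
      simp only [zero_add, pow_zero, pow_one, mul_one, mul_zero, add_zero] at hα2 ⊢
      norm_num at hK ⊢
      linarith
    | succ t =>
      have hK := mul_le_mul_of_nonneg_left (hKx (t + 3) (by omega)) (h_pos hC hξ (t + 2)).le
      have e : D.h (t + 2) * (Real.sqrt 3 * D.κ7 / (D.C * D.ξ) * D.upsBound rhat Pc CΘ (t + 1)
          + (2 * D.α * n + 1) / (2 * D.ξ) + n * D.η * D.β / (2 * D.ξ ^ 2) - 1 / 2)
          = Real.sqrt 3 * D.κ7 * (D.ξ ^ (t + 1) * D.upsBound rhat Pc CΘ (t + 1))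
            + (2 * D.α * n + 1) * (D.C / 2 * D.ξ ^ (t + 1))
            + D.η * D.β * (n * (D.C / 2 * D.ξ ^ t)) - D.h (t + 2) / 2 := by
        rw [h]
        field_simp
        ring
      rw [show t + 3 - 2 = t + 1 by omega, e, h] at hK
      have h2 := mul_le_mul_of_nonneg_left (hΘ (t + 1) (by omega) (by omega))
        (by positivity : 0 ≤ Real.sqrt 3 * D.κ7)
      have h3 := mul_le_mul_of_nonneg_left (hε (t + 1) (by omega) (by omega))
        (by positivity : 0 ≤ D.η * D.β)
      simp only [z, Nat.add_sub_cancel] at h2 h3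
      linarith
  · refine not_saturates_of_le hC hξ ?_
    have h1 := H.supNorm_z_le_l2_Θ (R.z_sum H (t + 1)) i
    -- The input is the new increment minus the last encoding error, so `Θ` is needed at time t + 2,
    -- whereas the x-input used time t + 1.
    have e1 : y (t + 2) i - s (t + 1) i
        = (y (t + 2) - y (t + 1)) i - (s (t + 1) i - y (t + 1) i) := by
      simp
    have h2 := R.supNorm_s_sub_y_le hC hξ hy0' (t := t + 1) (i := i)
      (fun _ => (hsat (t + 1) (by omega) le_rfl i).2)
    have e2 : ((t + 1 : ℕ) : ℤ) - 1 = (t : ℤ) := by push_cast; ring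
    rw [e2, zpow_natCast] at h2
    have hK := mul_le_mul_of_nonneg_left (hKy (t + 2) (by omega)) (h_pos hC hξ (t + 1)).le
    have e : D.h (t + 1) * (Real.sqrt 3 * D.κ8 / D.C * D.upsBound rhat Pc CΘ (t + 1)
        + (n * Real.sqrt m * D.β + 1) / (2 * D.ξ) - 1 / 2)
        = Real.sqrt 3 * D.κ8 * (D.ξ ^ (t + 1) * D.upsBound rhat Pc CΘ (t + 1))
          + (n * Real.sqrt m * D.β + 1) * (D.C / 2 * D.ξ ^ t) - D.h (t + 1) / 2 := by
      rw [h]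
      field_simp
      ring
    rw [show t + 2 - 1 = t + 1 by omega, e] at hK
    have h3 := mul_le_mul_of_nonneg_left (hΘ (t + 1) (by omega) le_rfl)
      (by positivity : 0 ≤ Real.sqrt 3 * D.κ8)
    have h4 := mul_le_mul_of_nonneg_left (hε (t + 1) (by omega) le_rfl) hβ
    simp only [z, Nat.add_sub_cancel] at h3 h4
    have h5 : n * 1 * D.β * (D.C / 2 * D.ξ ^ t) ≤ n * Real.sqrt m * D.β * (D.C / 2 * D.ξ ^ t) := by
      gcongr
    rw [e1]
    refine (supNorm_sub_le _ _).trans ?_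
    linarith

end Params

end
-- Induction over time
theorem theorem1 {n m : ℕ} (D : Params n m)
    -- the strongly connected digraph and the weight matrices
    (E : Digraph (Fin n)) (hE : StronglyConnected E)
    (hA : IsWeightMatrix E D.A) (hArow : ∀ i, ∑ j, D.A i j = 1)
    (hB : IsWeightMatrix E D.B) (hBcol : ∀ j, ∑ i, D.B i j = 1)
    (hα : D.α ∈ Set.Ioo (0 : ℝ) 1) (hβ : D.β ∈ Set.Ioo (0 : ℝ) 1)
    -- the local functions: strongly convex and smooth
    (hμ : 0 < D.μ) (hL : 0 < D.L)
    (hdiff : ∀ i, Differentiable ℝ (D.f i))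
    (hconv : ∀ i x y,
      D.f i x + inner ℝ (gradient (D.f i) x) (y - x) + D.μ / 2 * ‖x - y‖ ^ 2 ≤ D.f i y)
    (hsmooth : ∀ i x y, ‖gradient (D.f i) x - gradient (D.f i) y‖ ≤ D.L * ‖x - y‖)
    -- the optimal solution
    (xs : Vec m) (hxs : ∀ x, ∑ i, D.f i xs ≤ ∑ i, D.f i x)
    -- the left Perron vector of `A` and the right Perron vector of `B`
    (hπA : ∀ i, 0 ≤ D.πA i) (hπA1 : ∑ i, D.πA i = 1) (hπAe : D.πA ᵥ* D.A = D.πA)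
    (hπB : ∀ i, 0 ≤ D.πB i) (hπB1 : ∑ i, D.πB i = 1) (hπBe : D.B *ᵥ D.πB = D.πB)
    -- the two norms and the equivalence constants
    (hNA : ∀ v, l2 v ≤ D.NA v) (hNB : ∀ v, l2 v ≤ D.NB v)
    (hσA : D.σA < 1) (hσB : D.σB < 1)
    (hδAB : 0 < D.δAB ∧ ∀ v, D.NA v ≤ D.δAB * D.NB v)
    (hδA2 : 0 < D.δA2 ∧ ∀ v, D.NA v ≤ D.δA2 * l2 v)
    (hδB2 : 0 < D.δB2 ∧ ∀ v, D.NB v ≤ D.δB2 * l2 v)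
    -- the step size and the scaling function
    (hη : D.StepRange)
    (ϖ rhat Pc : ℝ) (hϖ : 0 < ϖ) (hrhat : rhat = specRad D.G + ϖ)
    (hPc : IsGeomConst D.G rhat Pc)
    (hC : 0 < D.C) (hξ : D.ξ ∈ Set.Ioo rhat 1)
    -- the run of the algorithm
    (Kx Ky : ℕ → ℕ) (ym : Fin n → Vec m) (x y p s : ℕ → Fin n → Vec m)
    (hrun : D.IsRun Kx Ky ym x y p s)
    (hy0 : ∑ i, y 0 i = 0) (hy0' : ∀ i, supNorm (y 0 i) ≤ D.C / (2 * D.ξ))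
    (CΘ : ℝ) (hCΘ : CΘ = l2 (D.Θ xs (x 1) (fun i => y 1 i - y 0 i)))
    -- the update rule for the quantization levels
    (hKx1 : ∀ i, supNorm (x 1 i) / D.C - 1 / 2 ≤ Kx 1)
    (hKy1 : ∀ i, supNorm (y 1 i) / D.C - 1 / 2 ≤ Ky 1)
    (hKx2 : Real.sqrt 3 * D.κ7 / (D.C * D.ξ) * CΘ + (2 * D.α * n + 1) / (2 * D.ξ) - 1 / 2 ≤ Kx 2)
    (hKx : ∀ k, 3 ≤ k →
      Real.sqrt 3 * D.κ7 / (D.C * D.ξ) * D.upsBound rhat Pc CΘ (k - 2)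
        + (2 * D.α * n + 1) / (2 * D.ξ) + n * D.η * D.β / (2 * D.ξ ^ 2) - 1 / 2 ≤ Kx k)
    (hKy : ∀ k, 2 ≤ k →
      Real.sqrt 3 * D.κ8 / D.C * D.upsBound rhat Pc CΘ (k - 1)
        + (n * Real.sqrt m * D.β + 1) / (2 * D.ξ) - 1 / 2 ≤ Ky k) :
    ∀ k, 1 ≤ k → ∀ i,
      ¬ Saturates (Kx k) (D.qInput x p k i) ∧ ¬ Saturates (Ky k) (D.qInput y s k i) := by
  intro k hk i
  have hn : 0 < n := i.pos
  -- For m = 0 all inputs are zero; otherwise m > 0 provides the unit vector behind μ ≤ L and the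
  -- bound √m ≥ 1.
  rcases Nat.eq_zero_or_pos m with rfl | hm
  · have h0 : ∀ (K : ℕ) (u : Vec 0), ¬ Saturates K u := fun K u => by
      have : supNorm u = 0 := by
        rw [Subsingleton.elim u 0]
        simp [supNorm]
      rw [Saturates, this, not_lt]
      positivity
    exact ⟨h0 _ _, h0 _ _⟩
  -- A spectral radius is nonnegative and ϖ > 0, so ξ > `rhat` > 0.
  have hξ0 : 0 < D.ξ := by
    refine lt_of_le_of_lt ?_ hξ.1
    rw [hrhat]
    exact add_nonneg ENNReal.toReal_nonneg hϖ.le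
  have weight_nonneg : ∀ W : Matrix (Fin n) (Fin n) ℝ, IsWeightMatrix E W → ∀ i j, 0 ≤ W i j :=
    fun W hW i j => by
      by_cases h : i = j ∨ E.Adj j i
      · exact ((hW i j).1 h).le
      · exact ((hW i j).2 h).ge
  have H : D.Admissible xs :=
    { n_pos := hn
      m_pos := hm
      A_nonneg := weight_nonneg _ hA
      A_row := hArow
      B_nonneg := weight_nonneg _ hB
      B_col := hBcol
      α_mem := hα
      β_mem := hβ
      μ_pos := hμ
      L_pos := hL
      diff := hdiff
      convex := hconv
      smooth := hsmooth
      isMin := hxs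
      πA_nonneg := hπA
      πA_sum := hπA1
      πA_eq := hπAe
      πB_nonneg := hπB
      πB_sum := hπB1
      πB_eq := hπBe
      l2_le_NA := hNA
      l2_le_NB := hNB
      σA_lt := hσA
      σB_lt := hσB
      δAB_pos := hδAB.1
      NA_le_NB := hδAB.2
      δA2_pos := hδA2.1
      NA_le_l2 := hδA2.2
      δB2_pos := hδB2.1
      NB_le_l2 := hδB2.2
      stepRange := hη }
  -- At time 1 the encoder starts from 0 and the scale is h(0) = C, so the levels cover the inputs
  -- directly.
  have first : ∀ (K : ℕ) (w q : ℕ → Fin n → Vec m), (∀ i, q 0 i = 0) →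
      (∀ i, supNorm (w 1 i) / D.C - 1 / 2 ≤ K) → ∀ i, ¬ Saturates K (D.qInput w q 1 i) := by
    intro K w q hq hK i
    refine Params.not_saturates_of_le hC hξ0 ?_
    rw [hq, sub_zero, Params.h, pow_zero, mul_one, ← div_le_iff₀' hC]
    linarith [hK i]
  induction k using Nat.strong_induction_on generalizing i with
  | _ k ih =>
    rcases Nat.lt_or_ge k 2 with h2 | h2
    · obtain rfl : k = 1 := by omega
      exact ⟨first _ x p hrun.p_zero hKx1 i, first _ y s hrun.s_zero hKy1 i⟩
    · obtain ⟨t, rfl⟩ := Nat.exists_eq_add_of_le' h2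
      exact H.not_saturates hC hξ0 hξ.2 hPc hrun hy0 hy0' hCΘ hKx2 hKx hKy
        (fun r hr1 hr j => ih r (by omega) hr1 j) i
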